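/- Conventions. Let $E$ be a real Banach space of dimension at least $2$ and let $D\subsetneq E$ be a proper subdomain (nonempty, open, connected). A curve in $D$ is a continuous map from a compact interval to $D$; $\ell(\gamma)$ is its length in the norm of $E$. Put $d_D(z)=\operatorname{dist}(z,\partial D)$, let $\ell_k(\gamma)=\int_\gamma |dz|/d_D(z)$ be the quasihyperbolic length of a rectifiable curve ($\ell_k(\gamma)=\infty$ if $\gamma$ is not rectifiable), and let $k_D(x,y)=\inf_\gamma \ell_k(\gamma)$, the infimum over all rectifiable curves in $D$ from $x$ to $y$. For $c\ge 1$, a curve $\gamma$ in $D$ is a $c$-quasigeodesic if $\ell_k(\gamma[x,y])\le c\,k_D(x,y)$ for every subcurve $\gamma[x,y]$ of $\gamma$ with end points $x,y$; $Q_{xy}^{c}$ is the set of $c$-quasigeodesics in $D$ with end points $x,y$. The domain $D$ is $\delta$-Gromov hyperbolic, $\delta>0$, if $(x|z)_p\ge\min\{(x|y)_p,(y|z)_p\}-\delta$ for all $x,y,z,p\in D$, where $2(x|y)_p=k_D(p,x)+k_D(p,y)-k_D(x,y)$. For $c_0>1$ and $\mu\in\mathbb R$, say that $c_0$-quasigeodesic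 triangles in $D$ are $\mu$-thin if for all distinct $x,y,z\in D$, all $\gamma_1\in Q^{c_0}_{xy}$, $\gamma_2\in Q^{c_0}_{yz}$, $\gamma_3\in Q^{c_0}_{xz}$ and all $u\in\gamma_1$ there is $v\in\gamma_2\cup\gamma_3$ with $k_D(u,v)\le\mu$. Theorem. For all $\delta>0$ and $c_0>1$ there is a constant $\mu_2=\mu_2(\delta,c_0)\ge \tfrac14+16+2\cdot 16$, depending only on $\delta$ and $c_0$ (not on $E$ or $D$), such that for every proper subdomain $D$ of a real Banach space $E$ of dimension at least $2$, if $D$ is $\delta$-Gromov hyperbolic, then: (1) $c_0$-quasigeodesic triangles in $D$ are $\mu_2$-thin; (2) for all $x_1,x_2\in D$ and all $\vartheta,\gamma\in Q^{c_0}_{x_1x_2}$, $$\max\{\ell(\vartheta),\ell(\gamma)\}\le 4e^{8c_0^2\mu_2}\min\{\ell(\vartheta),\ell(\gamma)\}.$$ Moreover, (2) holds with $\mu_2$ replaced by any number $\mu\ge\tfrac14+16+2\cdot16$ for which $c_0$-quasigeodesic triangles in $D$ are $\mu$-thin. -/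

import Mathlib

open Set MeasureTheory
open scoped ENNReal unitInterval

noncomputable section

namespace QH

/-- A proper subdomain of `E`: a nonempty connected open subset different from `E`. -/
structure IsProperSubdomain {E : Type*} [NormedAddCommGroup E] (D : Set E) : Prop where
  isOpen : IsOpen D
  isConnected : IsConnected D
  ne_univ : D ≠ univ

/-- `d_D(z)`, the distance from `z` to the boundary of `D`. -/
def bdist {E : Type*} [NormedAddCommGroup E] (D : Set E) (z : E) : ℝ :=
  Metric.infDist z (frontier D)

/-- The norm length of the part `γ[γ s, γ t]` of a curve, `s ≤ t`. -/
def lengthOn {E : Type*} [NormedAddCommGroup E] {x y : E} (γ : Path x y) (s t : I) : ℝ≥0∞ :=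
  eVariationOn γ (Icc s t)

/-- The norm length `ℓ(γ)` of a curve. -/
def length {E : Type*} [NormedAddCommGroup E] {x y : E} (γ : Path x y) : ℝ≥0∞ :=
  lengthOn γ 0 1

open Classical in
/-- The quasihyperbolic length of the part `γ[γ s, γ t]`, `s ≤ t`: the integral of `1 / d_D`
with respect to arc length, computed in the arc length parametrization of that part (and `∞` if
that part is not rectifiable). -/
def qhLengthOn {E : Type*} [NormedAddCommGroup E] (D : Set E) {x y : E} (γ : Path x y)
    (s t : I) : ℝ≥0∞ :=
  if lengthOn γ s t = ∞ then ∞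
  else ∫⁻ u in Icc (0 : ℝ) (lengthOn γ s t).toReal,
    ENNReal.ofReal (1 / bdist D (naturalParameterization γ (Icc s t) s u))

/-- The quasihyperbolic length `ℓ_k(γ)` of a curve. -/
def qhLength {E : Type*} [NormedAddCommGroup E] (D : Set E) {x y : E} (γ : Path x y) : ℝ≥0∞ :=
  qhLengthOn D γ 0 1

/-- The quasihyperbolic distance `k_D(x, y)`: the infimum of the quasihyperbolic lengths of the
rectifiable curves in `D` from `x` to `y`. (In a proper subdomain of a normed space, any two
points of `D` are joined by such a curve, of finite quasihyperbolic length.) -/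
def qhDist {E : Type*} [NormedAddCommGroup E] (D : Set E) (x y : E) : ℝ :=
  (⨅ γ : {γ : Path x y // (∀ t, γ t ∈ D) ∧ length γ ≠ ∞}, qhLength D γ.1).toReal

/-- A `c`-quasigeodesic in `D` from `x` to `y`; these curves form the class `Q_{xy}^c`. -/
def IsQuasigeodesic {E : Type*} [NormedAddCommGroup E] (D : Set E) (c : ℝ) {x y : E}
    (γ : Path x y) : Prop :=
  (∀ t, γ t ∈ D) ∧
    ∀ s t : I, s ≤ t → qhLengthOn D γ s t ≤ ENNReal.ofReal (c * qhDist D (γ s) (γ t))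

/-- The Gromov product `(x|y)_p` with respect to the quasihyperbolic metric of `D`. -/
def gromovProduct {E : Type*} [NormedAddCommGroup E] (D : Set E) (x y p : E) : ℝ :=
  (qhDist D p x + qhDist D p y - qhDist D x y) / 2

/-- `D` is `δ`-Gromov hyperbolic in its quasihyperbolic metric. -/
def IsGromovHyperbolic {E : Type*} [NormedAddCommGroup E] (D : Set E) (δ : ℝ) : Prop :=
  ∀ x ∈ D, ∀ y ∈ D, ∀ z ∈ D, ∀ p ∈ D,
    min (gromovProduct D x y p) (gromovProduct D y z p) - δ ≤ gromovProduct D x z p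

/-- Triangles in `D` with distinct vertices and `c₀`-quasigeodesic sides are `μ`-thin: each point
of one side is within quasihyperbolic distance `μ` of a point of the union of the other two. -/
def QuasigeodesicTrianglesThin {E : Type*} [NormedAddCommGroup E] (D : Set E) (c₀ μ : ℝ) :
    Prop :=
  ∀ x ∈ D, ∀ y ∈ D, ∀ z ∈ D, x ≠ y → y ≠ z → x ≠ z →
    ∀ (γ₁ : Path x y) (γ₂ : Path y z) (γ₃ : Path x z),
      IsQuasigeodesic D c₀ γ₁ → IsQuasigeodesic D c₀ γ₂ → IsQuasigeodesic D c₀ γ₃ →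
        ∀ u ∈ range γ₁, ∃ v ∈ range γ₂ ∪ range γ₃, qhDist D u v ≤ μ

end QH

end

/-!
The theorem has two independent halves.

*Thin triangles.* With its quasihyperbolic metric, a proper subdomain `D` is a length space: any two
points are joined by a curve whose length exceeds their distance by at most `1`, and such a "rough
geodesic" does the work of a geodesic. A quasigeodesic is a curve whose length is at most `c` times
the distance of its end points, on every subcurve. In any pseudometric space with the four point
condition, iterating that condition along repeated bisections of a curve shows that a curve going
round a ball has length exponential in the radius (`IsQuasiCurve.sub_le_metricProduct`). Hence a
bound for the distance of a rough geodesic from a quasigeodesic with the same end points can be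
halved until it is below a threshold depending only on `δ` and `c` (`IsQuasiCurve.halve_bound`,
`exists_roughGeodesic_near_quasiCurve`). By connectedness the end points of a quasigeodesic have
bounded Gromov product at each of its points (`IsQuasiCurve.metricProduct_le_of_near`), so for a
third vertex one of the two remaining Gromov products is bounded too, and the point is near the
corresponding side (`exists_thin_constant`).

*Comparison of lengths.* If triangles are `μ`-thin, each point of one side of a quasigeodesic bigon
is within `μ` of the other side. Cut both sides `θ` and `γ` into pieces of quasihyperbolic length
about `1`. As `d_D` changes at most by the factor `exp r` over a quasihyperbolic distance `r`
(`IsProperSubdomain.bdist_le_exp_mul`), the norm length of a piece is comparable to `d_D` at any of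
its points, hence, up to a factor of order `exp μ`, to the norm length of a nearby piece of the
other side. Only about `4 c μ` pieces of `θ` can be near the same piece of `γ`, because `θ` is a
quasigeodesic. Summing over the pieces compares the two lengths
(`IsQuasigeodesic.toReal_length_le_of_one_lt_qhDist`). When the end points are so close that there
is only one piece, `d_D` is nearly constant along both curves and the comparison is direct
(`IsQuasigeodesic.toReal_length_le_of_qhDist_le_one`).

The analytic groundwork is that the quasihyperbolic length, defined through the arc length
parametrization, is additive and invariant under monotone and antitone reparametrization, and that
the quasihyperbolic distance is a finite pseudometric for which the curves in `D` are continuous.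
-/

namespace QH

/-! ### Quasigeodesics in a hyperbolic pseudometric space -/

section Hyperbolic

variable {X : Type*} [PseudoMetricSpace X]

/-- The Gromov product `(x|y)_p` of a pseudometric space. -/
noncomputable def metricProduct (p x y : X) : ℝ := (dist p x + dist p y - dist x y) / 2

/-- Gromov's four point condition with constant `δ`. -/
def FourPoint (X : Type*) [PseudoMetricSpace X] (δ : ℝ) : Prop :=
  ∀ x y z p : X, min (metricProduct p x y) (metricProduct p y z) - δ ≤ metricProduct p x z

/-- A continuous curve `γ` with a function `L` whose increments play the role of the lengths of the
subcurves of `γ`: the increment over a subcurve lies between the distance of its end points and `c`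
times that distance. -/
structure IsQuasiCurve (c : ℝ) (γ : I → X) (L : I → ℝ) : Prop where
  continuous : Continuous γ
  dist_le : ∀ s t, s ≤ t → dist (γ s) (γ t) ≤ L t - L s
  le_mul_dist : ∀ s t, s ≤ t → L t - L s ≤ c * dist (γ s) (γ t)

/-- A continuous curve along which the triangle inequality is an equality up to an error `1`.
Such curves replace geodesics, which need not exist in a length space. -/
structure IsRoughGeodesic (α : I → X) : Prop where
  continuous : Continuous α
  add_le : ∀ s t r, s ≤ t → t ≤ r → dist (α s) (α t) + dist (α t) (α r) ≤ dist (α s) (α r) + 1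

lemma metricProduct_comm (p x y : X) : metricProduct p x y = metricProduct p y x := by
  unfold metricProduct; rw [dist_comm x y]; ring

lemma metricProduct_le_add_dist (p q x y : X) :
    metricProduct p x y ≤ metricProduct q x y + dist p q := by
  unfold metricProduct
  linarith [dist_triangle p q x, dist_triangle p q y]

lemma FourPoint.nonneg {δ : ℝ} (hδ : FourPoint X δ) (x : X) : 0 ≤ δ := by
  have := hδ x x x x
  simpa [metricProduct] using this

lemma IsQuasiCurve.monotone {c : ℝ} {γ : I → X} {L : I → ℝ} (h : IsQuasiCurve c γ L) :
    Monotone L := fun s t hst => by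
  linarith [h.dist_le s t hst, dist_nonneg (x := γ s) (y := γ t)]

/-- The length function is continuous because small subcurves of a quasigeodesic are short. -/
lemma IsQuasiCurve.continuous_length {c : ℝ} {γ : I → X} {L : I → ℝ} (h : IsQuasiCurve c γ L) :
    Continuous L := by
  rw [continuous_iff_continuousAt]
  intro s
  have h1 : Filter.Tendsto (fun t => c * dist (γ s) (γ t)) (nhds s) (nhds 0) := by
    have : Continuous fun t => c * dist (γ s) (γ t) :=
      continuous_const.mul (continuous_const.dist h.continuous)
    simpa using this.tendsto s
  rw [ContinuousAt, tendsto_iff_dist_tendsto_zero]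
  refine squeeze_zero (fun _ => dist_nonneg) (fun t => ?_) h1
  rcases le_total s t with hst | hst
  · rw [Real.dist_eq, abs_of_nonneg (by linarith [h.monotone hst])]
    exact h.le_mul_dist s t hst
  · rw [Real.dist_eq, abs_of_nonpos (by linarith [h.monotone hst]), dist_comm (γ s)]
    linarith [h.le_mul_dist t s hst]

/-- Exponential divergence: a curve that avoids the ball of radius `h` about `p`, and whose end
points have a small Gromov product at `p`, must have length exponential in `h`. -/
lemma IsQuasiCurve.sub_le_metricProduct {c δ h : ℝ} (hδ : FourPoint X δ) {γ : I → X} {L : I → ℝ}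
    (hγ : IsQuasiCurve c γ L) (p : X) (n : ℕ) : ∀ s t : I, s ≤ t → L t - L s ≤ 2 ^ n →
      (∀ τ ∈ Icc s t, h ≤ dist p (γ τ)) → h - 1 / 2 - n * δ ≤ metricProduct p (γ s) (γ t) := by
  induction n with
  | zero =>
    intro s t hst hL hp
    have h1 := hp s (left_mem_Icc.2 hst)
    have h2 := hp t (right_mem_Icc.2 hst)
    have h3 := hγ.dist_le s t hst
    unfold metricProduct
    norm_num at hL ⊢
    linarith
  | succ n ih =>
    intro s t hst hL hp
    obtain ⟨m, hm, hLm⟩ : ∃ m ∈ Icc s t, L m = (L s + L t) / 2 :=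
      intermediate_value_Icc hst hγ.continuous_length.continuousOn
        ⟨by linarith [hγ.monotone hst], by linarith [hγ.monotone hst]⟩
    rw [pow_succ] at hL
    have h1 := ih s m hm.1 (by linarith) fun τ hτ => hp τ ⟨hτ.1, hτ.2.trans hm.2⟩
    have h2 := ih m t hm.2 (by linarith) fun τ hτ => hp τ ⟨hm.1.trans hτ.1, hτ.2⟩
    have h3 := hδ (γ s) (γ m) (γ t) p
    have h4 := le_min h1 h2
    push_cast
    linarith

lemma IsRoughGeodesic.metricProduct_le {α : I → X} (hα : IsRoughGeodesic α) {s t r : I}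
    (h1 : s ≤ t) (h2 : t ≤ r) : metricProduct (α t) (α s) (α r) ≤ 1 / 2 := by
  have := hα.add_le s t r h1 h2
  unfold metricProduct
  rw [dist_comm (α t) (α s)]
  linarith

/-- Stepping back along a curve from `t`, one either reaches the initial point or a point at
distance exactly `r`. -/
lemma exists_le_dist_eq {α : I → X} (hα : Continuous α) {r : ℝ} (hr : 0 ≤ r) (t : I) :
    ∃ s ≤ t, dist (α t) (α s) ≤ r ∧ (s = 0 ∨ dist (α t) (α s) = r) := by
  rcases le_total (dist (α t) (α 0)) r with h | h
  · exact ⟨0, unitInterval.nonneg', h, Or.inl rfl⟩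
  · have hc : ContinuousOn (fun s => dist (α t) (α s)) (Icc 0 t) :=
      (continuous_const.dist hα).continuousOn
    obtain ⟨s, hs, hsr⟩ := intermediate_value_Icc' (unitInterval.nonneg' (t := t)) hc
      ⟨by simpa using hr, h⟩
    exact ⟨s, hs.2, hsr.le, Or.inr hsr⟩

lemma exists_ge_dist_eq {α : I → X} (hα : Continuous α) {r : ℝ} (hr : 0 ≤ r) (t : I) :
    ∃ s ≥ t, dist (α t) (α s) ≤ r ∧ (s = 1 ∨ dist (α t) (α s) = r) := by
  rcases le_total (dist (α t) (α 1)) r with h | h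
  · exact ⟨1, unitInterval.le_one', h, Or.inl rfl⟩
  · have hc : ContinuousOn (fun s => dist (α t) (α s)) (Icc t 1) :=
      (continuous_const.dist hα).continuousOn
    obtain ⟨s, hs, hsr⟩ := intermediate_value_Icc (unitInterval.le_one' (t := t)) hc
      ⟨by simpa using hr, h⟩
    exact ⟨s, hs.1, hsr.le, Or.inr hsr⟩

/-- The self-improvement step of the stability theorem: a bound `B` for the distance of the points
of a rough geodesic from a quasigeodesic with the same end points can be halved as long as `B` is
so large that a curve of length `6 c B` is too short to go round a ball of radius `B / 2`. -/
lemma IsQuasiCurve.halve_bound {c δ B : ℝ} (hδ : FourPoint X δ) (hc : 0 ≤ c) (hB : 0 ≤ B)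
    {n : ℕ} (hn : 6 * c * B ≤ 2 ^ n) (hBn : 1 + (n + 2) * δ < B / 2)
    {γ α : I → X} {L : I → ℝ} (hγ : IsQuasiCurve c γ L) (hα : IsRoughGeodesic α)
    (h0 : γ 0 = α 0) (h1 : γ 1 = α 1) (h : ∀ t, ∃ τ, dist (α t) (γ τ) ≤ B) (t : I) :
    ∃ τ, dist (α t) (γ τ) ≤ B / 2 := by
  by_contra! hcon
  have hδ0 : 0 ≤ δ := hδ.nonneg (α t)
  set p := α t with hp
  obtain ⟨a, hat, har, ha⟩ := exists_le_dist_eq hα.continuous (r := 2 * B) (by linarith) t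
  obtain ⟨b, htb, hbr, hb⟩ := exists_ge_dist_eq hα.continuous (r := 2 * B) (by linarith) t
  -- the endpoint of `α` is the endpoint of `γ`, and a point at distance `2 * B` has a companion
  -- on `γ` so close that the Gromov product at `p` stays large
  have key : ∀ s : I, (s = 0 ∨ s = 1 ∨ dist p (α s) = 2 * B) →
      ∃ τ, dist (α s) (γ τ) ≤ B ∧ B / 2 ≤ metricProduct p (α s) (γ τ) := by
    intro s hs
    have end_case : ∀ e : I, γ e = α e →
        ∃ τ, dist (α e) (γ τ) ≤ B ∧ B / 2 ≤ metricProduct p (α e) (γ τ) := fun e he =>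
      ⟨e, by simpa [he] using hB, by
        have := hcon e
        unfold metricProduct
        rw [he, dist_self]; rw [he] at this; linarith⟩
    rcases hs with rfl | rfl | hs
    · exact end_case 0 h0
    · exact end_case 1 h1
    · obtain ⟨τ, hτ⟩ := h s
      refine ⟨τ, hτ, ?_⟩
      unfold metricProduct
      have := dist_triangle p (γ τ) (α s)
      rw [dist_comm (γ τ) (α s)] at this
      have := hcon τ
      linarith
  obtain ⟨a', haa, hga⟩ := key a (by tauto)
  obtain ⟨b', hbb, hgb⟩ := key b (by tauto)
  have hlen : dist (γ a') (γ b') ≤ 6 * B := by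
    have e1 := dist_triangle4 (γ a') (α a) p (γ b')
    have e2 := dist_triangle p (α b) (γ b')
    rw [dist_comm (γ a') (α a), dist_comm (α a) p] at e1
    linarith
  have hmid : B / 2 - 1 / 2 - n * δ ≤ metricProduct p (γ a') (γ b') := by
    have aux : ∀ s r : I, s ≤ r → dist (γ s) (γ r) ≤ 6 * B →
        B / 2 - 1 / 2 - n * δ ≤ metricProduct p (γ s) (γ r) := fun s r hsr hd =>
      hγ.sub_le_metricProduct hδ p n s r hsr
        (by have := hγ.le_mul_dist s r hsr
            have := mul_le_mul_of_nonneg_left hd hc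
            linarith) fun τ _ => (hcon τ).le
    rcases le_total a' b' with hab | hab
    · exact aux a' b' hab hlen
    · rw [metricProduct_comm]; exact aux b' a' hab (by rwa [dist_comm])
  have hsmall := hα.metricProduct_le hat htb
  rw [← hp] at hsmall
  have c1 := hδ (γ a') (γ b') (α b) p
  rw [metricProduct_comm p (γ b')] at c1
  have c2 := hδ (α a) (γ a') (α b) p
  have hnδ : 0 ≤ (n : ℝ) * δ := by positivity
  have m1 : B / 2 - 1 / 2 - n * δ - δ ≤ metricProduct p (γ a') (α b) :=
    (sub_le_sub_right (le_min hmid (by linarith)) δ).trans c1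
  have m2 : B / 2 - 1 / 2 - n * δ - δ - δ ≤ metricProduct p (α a) (α b) :=
    (sub_le_sub_right (le_min (by linarith) m1) δ).trans c2
  linarith

/-- Logarithms grow slower than linear functions, in the form that makes the halving of bounds
possible. -/
lemma exists_halving_threshold (δ c : ℝ) (hc : 1 ≤ c) :
    ∃ B₀ : ℝ, 1 ≤ B₀ ∧ ∀ B ≥ B₀, ∃ n : ℕ, 6 * c * B ≤ 2 ^ n ∧ 1 + (n + 2) * δ < B / 2 := by
  have hlim : Filter.Tendsto
      (fun n : ℕ => |δ| * ((n : ℝ) ^ 1 / 2 ^ n) + (1 + 3 * |δ|) * (1 / 2) ^ n)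
      Filter.atTop (nhds 0) := by
    simpa using ((tendsto_pow_const_div_const_pow_of_one_lt 1 one_lt_two).const_mul |δ|).add
      ((tendsto_pow_atTop_nhds_zero_of_lt_one (r := (1 / 2 : ℝ)) (by norm_num)
        (by norm_num)).const_mul (1 + 3 * |δ|))
  have hc' : 0 < 12 * c := by linarith
  obtain ⟨N, hN⟩ := Filter.eventually_atTop.1 (hlim.eventually (gt_mem_nhds (inv_pos.2 hc')))
  -- `B ≥ 2 ^ (N + 1)` forces `n ≥ N` for the `n` with `2 ^ n ≤ 6 * c * B < 2 ^ (n + 1)`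
  refine ⟨2 ^ (N + 1), one_le_pow₀ one_le_two, fun B hB => ?_⟩
  have hB1 : 1 ≤ B := (one_le_pow₀ one_le_two).trans hB
  obtain ⟨n, hn1, hn2⟩ := exists_nat_pow_near (x := 6 * c * B) (y := (2 : ℝ))
    (by nlinarith) one_lt_two
  refine ⟨n + 1, hn2.le, ?_⟩
  have hNn : N ≤ n := by
    by_contra! hlt
    have h1 : (2 : ℝ) ^ (n + 1) ≤ 2 ^ (N + 1) := pow_le_pow_right₀ one_le_two (by omega)
    nlinarith
  have h3 := hN n hNn
  have h4 : |δ| * ((n : ℝ) ^ 1 / 2 ^ n) + (1 + 3 * |δ|) * (1 / 2) ^ n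
      = (1 + (n + 3) * |δ|) / 2 ^ n := by
    rw [one_div, inv_pow]; field_simp; ring
  rw [h4, div_lt_iff₀ (by positivity), inv_mul_eq_div, lt_div_iff₀ hc'] at h3
  have h5 : (1 + (n + 3) * |δ|) * 2 < B := by
    have := h3.trans_le hn1
    nlinarith
  have h6 : ((n : ℝ) + 3) * δ ≤ (n + 3) * |δ| :=
    mul_le_mul_of_nonneg_left (le_abs_self δ) (by positivity)
  push_cast
  linarith

/-- Stability of quasigeodesics, first half: rough geodesics stay near quasigeodesics with the
same end points. -/
lemma exists_roughGeodesic_near_quasiCurve (δ c : ℝ) (hc : 1 ≤ c) :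
    ∃ R : ℝ, 1 ≤ R ∧ ∀ {X : Type*} [PseudoMetricSpace X], FourPoint X δ →
      ∀ {γ α : I → X} {L : I → ℝ}, IsQuasiCurve c γ L → IsRoughGeodesic α →
        γ 0 = α 0 → γ 1 = α 1 → ∀ t, ∃ τ, dist (α t) (γ τ) ≤ R := by
  obtain ⟨B₀, hB₀, hB⟩ := exists_halving_threshold δ c hc
  refine ⟨B₀, hB₀, fun {X} _ hδ γ α L hγ hα h0 h1 => ?_⟩
  have descend : ∀ k : ℕ, (∀ t, ∃ τ, dist (α t) (γ τ) ≤ 2 ^ k * B₀) →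
      ∀ t, ∃ τ, dist (α t) (γ τ) ≤ B₀ := by
    intro k
    induction k with
    | zero => simp
    | succ k ih =>
      intro h
      refine ih fun t => ?_
      have hle : B₀ ≤ 2 ^ (k + 1) * B₀ :=
        le_mul_of_one_le_left (by linarith) (one_le_pow₀ one_le_two)
      obtain ⟨n, hn, hn'⟩ := hB _ hle
      obtain ⟨τ, hτ⟩ := hγ.halve_bound hδ (by linarith) (by linarith) hn hn' hα h0 h1 h t
      exact ⟨τ, hτ.trans_eq (by rw [pow_succ]; ring)⟩
  obtain ⟨k, hk⟩ := pow_unbounded_of_one_lt (dist (α 0) (α 1) + 1) one_lt_two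
  refine descend k fun t => ⟨0, ?_⟩
  rw [h0]
  have h3 := hα.add_le 0 t 1 unitInterval.nonneg' unitInterval.le_one'
  have h4 : (2 : ℝ) ^ k ≤ 2 ^ k * B₀ := le_mul_of_one_le_right (by positivity) hB₀
  rw [dist_comm]
  linarith [dist_nonneg (x := α t) (y := α 1)]

/-- Second half of stability: at a point of a quasigeodesic, the Gromov product of the end points
is bounded. By connectedness, some point of the rough geodesic is near both halves of the
quasigeodesic, and the part in between is then short. -/
lemma IsQuasiCurve.metricProduct_le_of_near {c R : ℝ} (hR : 0 ≤ R) (hc : 0 ≤ c)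
    {γ α : I → X} {L : I → ℝ} (hγ : IsQuasiCurve c γ L) (hα : IsRoughGeodesic α)
    (h0 : γ 0 = α 0) (h1 : γ 1 = α 1) (h : ∀ t, ∃ τ, dist (α t) (γ τ) ≤ R) (t : I) :
    metricProduct (γ t) (γ 0) (γ 1) ≤ 1 / 2 + c * (2 * (R + 1)) + (R + 1) := by
  have hopen : ∀ S : Set I, IsOpen {r | ∃ τ ∈ S, dist (α r) (γ τ) < R + 1} := by
    intro S
    have : {r | ∃ τ ∈ S, dist (α r) (γ τ) < R + 1} =
        ⋃ τ ∈ S, {r | dist (α r) (γ τ) < R + 1} := by ext; simp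
    rw [this]
    exact isOpen_biUnion fun τ _ =>
      isOpen_lt (hα.continuous.dist continuous_const) continuous_const
  obtain ⟨r, -, ⟨s, hst, hs⟩, ⟨s', hst', hs'⟩⟩ := isPreconnected_univ
    _ _ (hopen (Iic t)) (hopen (Ici t))
    (fun r _ => by
      obtain ⟨τ, hτ⟩ := h r
      rcases le_total τ t with hτt | hτt
      · exact Or.inl ⟨τ, hτt, by linarith⟩
      · exact Or.inr ⟨τ, hτt, by linarith⟩)
    ⟨0, mem_univ _, 0, unitInterval.nonneg', by simpa [h0] using by linarith⟩
    ⟨1, mem_univ _, 1, unitInterval.le_one', by simpa [h1] using by linarith⟩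
  have hst : s ≤ t := hst
  have hst' : t ≤ s' := hst'
  have d1 : dist (γ s) (γ s') ≤ 2 * (R + 1) := by
    have := dist_triangle_left (γ s) (γ s') (α r)
    linarith
  have d2 : dist (γ s) (γ t) ≤ c * (2 * (R + 1)) := by
    have e1 := hγ.le_mul_dist s s' (hst.trans hst')
    have e2 := hγ.dist_le s t hst
    have e3 := hγ.monotone hst'
    have e4 := mul_le_mul_of_nonneg_left d1 hc
    linarith
  have d3 : dist (γ t) (α r) ≤ c * (2 * (R + 1)) + (R + 1) := by
    have := dist_triangle_left (γ t) (α r) (γ s)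
    rw [dist_comm (γ s) (α r)] at this
    linarith
  have e := metricProduct_le_add_dist (γ t) (α r) (γ 0) (γ 1)
  have e' := hα.metricProduct_le (unitInterval.nonneg' (t := r)) unitInterval.le_one'
  rw [h0, h1] at e ⊢
  linarith

/-- A point at which the end points of a rough geodesic have a small Gromov product is near the
rough geodesic, namely near its point at the same distance from the initial point. -/
lemma IsRoughGeodesic.exists_dist_le {δ C : ℝ} (hδ : FourPoint X δ) {α : I → X}
    (hα : IsRoughGeodesic α) (p : X) (hp : metricProduct p (α 0) (α 1) ≤ C) :
    ∃ t, dist p (α t) ≤ 1 + 2 * C + 2 * δ := by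
  have hδ0 := hδ.nonneg p
  have hC : 0 ≤ 2 * C := by
    unfold metricProduct at hp
    have := dist_triangle_left (α 0) (α 1) p
    linarith
  have hp' : dist p (α 0) + dist p (α 1) ≤ dist (α 0) (α 1) + 2 * C := by
    unfold metricProduct at hp; linarith
  obtain ⟨t, -, ht, ht'⟩ := exists_ge_dist_eq hα.continuous (dist_nonneg (x := p) (y := α 0)) 0
  refine ⟨t, ?_⟩
  rcases ht' with rfl | ht'
  · linarith
  · have e := hα.add_le 0 t 1 unitInterval.nonneg' unitInterval.le_one'
    -- the four point condition based at the terminal point gives the bound on `dist p (α t)`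
    have f := hδ p (α 0) (α t) (α 1)
    have g := dist_comm (α 0) (α 1)
    have g1 := dist_comm (α 1) p
    have g2 := dist_comm (α 1) (α t)
    have g3 := dist_comm (α 0) p
    unfold metricProduct at f
    rcases min_le_iff.1 (sub_le_iff_le_add.1 f) with f | f <;> linarith

/-- Triangles of quasigeodesics are thin, with a constant that depends only on the hyperbolicity
constant `δ` and the quasigeodesic constant `c`. -/
theorem exists_thin_constant (δ c : ℝ) (hc : 1 ≤ c) :
    ∃ M : ℝ, ∀ {X : Type*} [PseudoMetricSpace X], FourPoint X δ →
      (∀ x y : X, ∃ α : I → X, IsRoughGeodesic α ∧ α 0 = x ∧ α 1 = y) →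
      ∀ {γ₁ γ₂ γ₃ : I → X} {L₁ L₂ L₃ : I → ℝ}, IsQuasiCurve c γ₁ L₁ → IsQuasiCurve c γ₂ L₂ →
        IsQuasiCurve c γ₃ L₃ → γ₁ 0 = γ₃ 0 → γ₁ 1 = γ₂ 0 → γ₂ 1 = γ₃ 1 →
        ∀ t, ∃ v ∈ range γ₂ ∪ range γ₃, dist (γ₁ t) v ≤ M := by
  obtain ⟨R, hR, hnear⟩ := exists_roughGeodesic_near_quasiCurve δ c hc
  set C := 1 / 2 + c * (2 * (R + 1)) + (R + 1) with hC
  refine ⟨1 + 2 * (C + δ) + 2 * δ + R,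
    fun {X} _ hδ hgeo γ₁ γ₂ γ₃ L₁ L₂ L₃ h₁ h₂ h₃ h13 h12 h23 t => ?_⟩
  have near : ∀ {γ : I → X} {L : I → ℝ}, IsQuasiCurve c γ L → ∀ p : X,
      metricProduct p (γ 0) (γ 1) ≤ C + δ →
      ∃ τ, dist p (γ τ) ≤ 1 + 2 * (C + δ) + 2 * δ + R := by
    intro γ L hγ p hp
    obtain ⟨α, hα, h0, h1⟩ := hgeo (γ 0) (γ 1)
    rw [← h0, ← h1] at hp
    obtain ⟨s, hs⟩ := hα.exists_dist_le hδ p hp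
    obtain ⟨τ, hτ⟩ := hnear hδ hγ hα h0.symm h1.symm s
    exact ⟨τ, (dist_triangle _ (α s) _).trans (by linarith)⟩
  obtain ⟨α, hα, h0, h1⟩ := hgeo (γ₁ 0) (γ₁ 1)
  have hprod := h₁.metricProduct_le_of_near (by linarith) (by linarith) hα h0.symm h1.symm
    (hnear hδ h₁ hα h0.symm h1.symm) t
  rw [← hC] at hprod
  have h4 : min (metricProduct (γ₁ t) (γ₁ 0) (γ₃ 1))
      (metricProduct (γ₁ t) (γ₃ 1) (γ₁ 1)) ≤ C + δ := by
    linarith [hδ (γ₁ 0) (γ₃ 1) (γ₁ 1) (γ₁ t)]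
  rcases min_le_iff.1 h4 with h | h
  · rw [h13] at h
    obtain ⟨τ, hτ⟩ := near h₃ _ h
    exact ⟨_, Or.inr ⟨τ, rfl⟩, hτ⟩
  · rw [metricProduct_comm, h12, ← h23] at h
    obtain ⟨τ, hτ⟩ := near h₂ _ h
    exact ⟨_, Or.inl ⟨τ, rfl⟩, hτ⟩

end Hyperbolic

/-! ### Arc length and quasihyperbolic length -/

section Length

variable {E : Type*} [NormedAddCommGroup E] {x y x' y' : E}

lemma lengthOn_add_lengthOn (γ : Path x y) {s t r : I} (hst : s ≤ t) (htr : t ≤ r) :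
    lengthOn γ s t + lengthOn γ t r = lengthOn γ s r := by
  simpa [lengthOn] using eVariationOn.Icc_add_Icc γ hst htr (mem_univ t)

lemma lengthOn_mono (γ : Path x y) {s t s' t' : I} (hs : s' ≤ s) (ht : t ≤ t') :
    lengthOn γ s t ≤ lengthOn γ s' t' :=
  eVariationOn.mono _ (Icc_subset_Icc hs ht)

lemma lengthOn_ne_top_of_le (γ : Path x y) {s t s' t' : I} (hs : s' ≤ s) (ht : t ≤ t')
    (h : lengthOn γ s' t' ≠ ∞) : lengthOn γ s t ≠ ∞ :=
  ne_top_of_le_ne_top h (lengthOn_mono γ hs ht)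

@[simp] lemma lengthOn_self (γ : Path x y) (s : I) : lengthOn γ s s = 0 :=
  eVariationOn.subsingleton _ (by simp)

lemma edist_le_lengthOn (γ : Path x y) {s t : I} (hst : s ≤ t) :
    edist (γ s) (γ t) ≤ lengthOn γ s t :=
  eVariationOn.edist_le _ (left_mem_Icc.2 hst) (right_mem_Icc.2 hst)

/-- The arc length is continuous, so it takes all values between `0` and the length. Therefore the
natural parametrization has no junk values on that interval. -/
lemma continuousOn_toReal_lengthOn (γ : Path x y) {s t : I} (h : lengthOn γ s t ≠ ∞) :
    ContinuousOn (fun τ => (lengthOn γ s τ).toReal) (Icc s t) := by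
  have hbv : BoundedVariationOn γ (Icc s t) := h
  intro a ha
  have hl := hbv.tendsto_eVariationOn_Icc_zero_left (x := a)
    γ.continuous.continuousAt.continuousWithinAt
  have hr := hbv.tendsto_eVariationOn_Icc_zero_right a
    γ.continuous.continuousAt.continuousWithinAt
  have hsum := (ENNReal.tendsto_toReal ENNReal.zero_ne_top).comp (by simpa using hl.add hr)
  rw [ContinuousWithinAt, tendsto_iff_dist_tendsto_zero]
  refine squeeze_zero' (Filter.Eventually.of_forall fun _ => dist_nonneg) ?_
    (by simpa using hsum)
  filter_upwards [self_mem_nhdsWithin] with b hb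
  have key : ∀ a ∈ Icc s t, ∀ b ∈ Icc s t, a ≤ b →
      |(lengthOn γ s b).toReal - (lengthOn γ s a).toReal| =
        (eVariationOn γ (Icc s t ∩ Icc a b)).toReal := by
    intro a ha b hb hab
    have e : Icc s t ∩ Icc a b = Icc a b :=
      inter_eq_right.2 (Icc_subset_Icc ha.1 hb.2)
    have h1 := lengthOn_add_lengthOn γ ha.1 hab
    rw [e, ← h1, ENNReal.toReal_add (lengthOn_ne_top_of_le γ le_rfl ha.2 h)
      (lengthOn_ne_top_of_le γ ha.1 hb.2 h), add_sub_cancel_left, abs_of_nonneg (by positivity)]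
    rfl
  have hfin : ∀ a b, eVariationOn γ (Icc s t ∩ Icc a b) ≠ ∞ := fun a b =>
    ne_top_of_le_ne_top h (eVariationOn.mono _ inter_subset_left)
  rw [Function.comp_apply, ENNReal.toReal_add (hfin _ _) (hfin _ _), Real.dist_eq]
  rcases le_total a b with hab | hab
  · rw [key a ha b hb hab]
    exact le_add_of_nonneg_left ENNReal.toReal_nonneg
  · rw [abs_sub_comm, key b hb a ha hab]
    exact le_add_of_nonneg_right ENNReal.toReal_nonneg

lemma exists_lengthOn_eq (γ : Path x y) {s t : I} (hst : s ≤ t) (h : lengthOn γ s t ≠ ∞) {u : ℝ}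
    (hu : u ∈ Icc 0 (lengthOn γ s t).toReal) :
    ∃ τ ∈ Icc s t, (lengthOn γ s τ).toReal = u :=
  intermediate_value_Icc hst (continuousOn_toReal_lengthOn γ h) (by simpa using hu)

lemma naturalParameterization_lengthOn (γ : Path x y) {s t τ : I} (h : lengthOn γ s t ≠ ∞)
    (hτ : τ ∈ Icc s t) :
    naturalParameterization γ (Icc s t) s (lengthOn γ s τ).toReal = γ τ := by
  have hbv : BoundedVariationOn γ (Icc s t) := h
  have e := edist_naturalParameterization_eq_zero hbv.locallyBoundedVariationOn
    (left_mem_Icc.2 (hτ.1.trans hτ.2)) hτ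
  rw [edist_eq_zero, variationOnFromTo.eq_of_le _ _ hτ.1,
    inter_eq_right.2 (Icc_subset_Icc le_rfl hτ.2)] at e
  exact e

variable (D : Set E)

lemma qhLengthOn_eq_top (γ : Path x y) {s t : I} (h : lengthOn γ s t = ∞) :
    qhLengthOn D γ s t = ∞ := by
  rw [qhLengthOn, if_pos h]

lemma lengthOn_ne_top (γ : Path x y) {s t : I} (h : qhLengthOn D γ s t ≠ ∞) :
    lengthOn γ s t ≠ ∞ := fun h' => h (qhLengthOn_eq_top D γ h')

/-- The quasihyperbolic length can be computed with any function that composed with the arc length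
gives back the curve. -/
lemma qhLengthOn_eq_lintegral (γ : Path x y) {s t : I} (hst : s ≤ t) (h : lengthOn γ s t ≠ ∞)
    (g : ℝ → E) (hg : ∀ τ ∈ Icc s t, g (lengthOn γ s τ).toReal = γ τ) :
    qhLengthOn D γ s t =
      ∫⁻ u in Icc (0 : ℝ) (lengthOn γ s t).toReal, ENNReal.ofReal (1 / bdist D (g u)) := by
  rw [qhLengthOn, if_neg h]
  refine setLIntegral_congr_fun measurableSet_Icc fun u hu => ?_
  obtain ⟨τ, hτ, rfl⟩ := exists_lengthOn_eq γ hst h hu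
  simp only [naturalParameterization_lengthOn γ h hτ, hg τ hτ]

lemma lengthOn_comp_of_monotone {γ : Path x y} {γ' : Path x' y'} {φ : I → I} (hφ : Monotone φ)
    (hφc : Continuous φ) (hγ : ∀ τ, γ' τ = γ (φ τ)) {s t : I} (hst : s ≤ t) :
    lengthOn γ' s t = lengthOn γ (φ s) (φ t) := by
  have himg : φ '' Icc s t = Icc (φ s) (φ t) :=
    (hφ.monotoneOn _).image_Icc_subset.antisymm (intermediate_value_Icc hst hφc.continuousOn)
  have hcomp : (γ' : I → E) = γ ∘ φ := funext hγ
  rw [lengthOn, hcomp, eVariationOn.comp_eq_of_monotoneOn _ _ (hφ.monotoneOn _), himg, lengthOn]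

lemma lengthOn_comp_of_antitone {γ : Path x y} {γ' : Path x' y'} {φ : I → I} (hφ : Antitone φ)
    (hφc : Continuous φ) (hγ : ∀ τ, γ' τ = γ (φ τ)) {s t : I} (hst : s ≤ t) :
    lengthOn γ' s t = lengthOn γ (φ t) (φ s) := by
  have himg : φ '' Icc s t = Icc (φ t) (φ s) :=
    (hφ.antitoneOn _).image_Icc_subset.antisymm (intermediate_value_Icc' hst hφc.continuousOn)
  have hcomp : (γ' : I → E) = γ ∘ φ := funext hγ
  rw [lengthOn, hcomp, eVariationOn.comp_eq_of_antitoneOn _ _ (hφ.antitoneOn _), himg, lengthOn]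

lemma qhLengthOn_comp_of_monotone {γ : Path x y} {γ' : Path x' y'} {φ : I → I} (hφ : Monotone φ)
    (hφc : Continuous φ) (hγ : ∀ τ, γ' τ = γ (φ τ)) {s t : I} (hst : s ≤ t) :
    qhLengthOn D γ' s t = qhLengthOn D γ (φ s) (φ t) := by
  have hl := lengthOn_comp_of_monotone hφ hφc hγ hst
  by_cases h : lengthOn γ (φ s) (φ t) = ∞
  · rw [qhLengthOn_eq_top D γ h, qhLengthOn_eq_top D γ' (hl.trans h)]
  rw [qhLengthOn_eq_lintegral D γ' hst (by rwa [hl])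
    (naturalParameterization γ (Icc (φ s) (φ t)) (φ s)), qhLengthOn, if_neg h, hl]
  intro τ hτ
  rw [lengthOn_comp_of_monotone hφ hφc hγ hτ.1,
    naturalParameterization_lengthOn γ h ⟨hφ hτ.1, hφ hτ.2⟩, hγ]

lemma qhLengthOn_comp_of_antitone {γ : Path x y} {γ' : Path x' y'} {φ : I → I} (hφ : Antitone φ)
    (hφc : Continuous φ) (hγ : ∀ τ, γ' τ = γ (φ τ)) {s t : I} (hst : s ≤ t) :
    qhLengthOn D γ' s t = qhLengthOn D γ (φ t) (φ s) := by
  have hl := lengthOn_comp_of_antitone hφ hφc hγ hst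
  by_cases h : lengthOn γ (φ t) (φ s) = ∞
  · rw [qhLengthOn_eq_top D γ h, qhLengthOn_eq_top D γ' (hl.trans h)]
  set ℓ := (lengthOn γ (φ t) (φ s)).toReal with hℓ
  set g := naturalParameterization γ (Icc (φ t) (φ s)) (φ t) with hg
  rw [qhLengthOn_eq_lintegral D γ' hst (by rwa [hl]) (fun u => g (ℓ - u)), qhLengthOn, if_neg h,
    hl, ← hg, ← hℓ, ← lintegral_indicator measurableSet_Icc,
    ← lintegral_indicator measurableSet_Icc, ← lintegral_sub_left_eq_self _ ℓ]
  · refine lintegral_congr fun u => ?_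
    have : u ∈ Icc 0 ℓ ↔ ℓ - u ∈ Icc 0 ℓ := by
      simp only [mem_Icc]; constructor <;> rintro ⟨h1, h2⟩ <;> constructor <;> linarith
    by_cases hu : ℓ - u ∈ Icc 0 ℓ
    · rw [indicator_of_mem hu, indicator_of_mem (this.2 hu)]
      simp
    · rw [indicator_of_notMem hu, indicator_of_notMem (fun h => hu (this.1 h))]
  · intro τ hτ
    have e := lengthOn_add_lengthOn γ (hφ hτ.2) (hφ hτ.1)
    have h1 := lengthOn_ne_top_of_le γ le_rfl (hφ hτ.1) h
    have h2 := lengthOn_ne_top_of_le γ (hφ hτ.2) le_rfl h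
    have e' : ℓ - (lengthOn γ (φ τ) (φ s)).toReal = (lengthOn γ (φ t) (φ τ)).toReal := by
      rw [hℓ, ← e, ENNReal.toReal_add h1 h2, add_sub_cancel_right]
    rw [lengthOn_comp_of_antitone hφ hφc hγ hτ.1, e', hg,
      naturalParameterization_lengthOn γ h ⟨hφ hτ.2, hφ hτ.1⟩, hγ]

lemma qhLengthOn_add_qhLengthOn (γ : Path x y) {s t r : I} (hst : s ≤ t) (htr : t ≤ r) :
    qhLengthOn D γ s t + qhLengthOn D γ t r = qhLengthOn D γ s r := by
  have hadd := lengthOn_add_lengthOn γ hst htr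
  by_cases h : lengthOn γ s r = ∞
  · rw [qhLengthOn_eq_top D γ h]
    rw [h, ENNReal.add_eq_top] at hadd
    rcases hadd with h' | h' <;> simp [qhLengthOn_eq_top D γ h']
  have h1 := lengthOn_ne_top_of_le γ le_rfl htr h
  have h2 := lengthOn_ne_top_of_le γ hst le_rfl h
  set g := naturalParameterization γ (Icc s r) s with hg
  set a := (lengthOn γ s t).toReal with ha
  set b := (lengthOn γ t r).toReal with hb
  have hab : (lengthOn γ s r).toReal = a + b := by
    rw [← hadd, ENNReal.toReal_add h1 h2]
  have ha0 : 0 ≤ a := ENNReal.toReal_nonneg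
  have hb0 : 0 ≤ b := ENNReal.toReal_nonneg
  rw [qhLengthOn_eq_lintegral D γ hst h1 g fun τ hτ =>
      naturalParameterization_lengthOn γ h ⟨hτ.1, hτ.2.trans htr⟩,
    qhLengthOn_eq_lintegral D γ htr h2 (fun u => g (u + a)) fun τ hτ => ?_,
    qhLengthOn, if_neg h, hab, ← hg, ← ha, ← hb,
    ← Icc_union_Ioc_eq_Icc (c := a + b) ha0 (by linarith),
    lintegral_union measurableSet_Ioc (by
      rw [Set.disjoint_left]; rintro u ⟨_, h1⟩ ⟨h2, _⟩; exact absurd h1 (not_le.2 h2)),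
    setLIntegral_congr (Ioc_ae_eq_Icc (a := a) (b := a + b))]
  · congr 1
    rw [← lintegral_indicator measurableSet_Icc, ← lintegral_indicator measurableSet_Icc,
      ← lintegral_add_right_eq_self
        ((Icc a (a + b)).indicator fun u => ENNReal.ofReal (1 / bdist D (g u))) a]
    refine lintegral_congr fun u => ?_
    have : u ∈ Icc 0 b ↔ u + a ∈ Icc a (a + b) := by
      simp only [mem_Icc]; constructor <;> rintro ⟨h1, h2⟩ <;> constructor <;> linarith
    by_cases hu : u ∈ Icc 0 b
    · rw [indicator_of_mem hu, indicator_of_mem (this.1 hu)]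
    · rw [indicator_of_notMem hu, indicator_of_notMem (fun h => hu (this.2 h))]
  · have e := lengthOn_add_lengthOn γ hst hτ.1
    have e' : (lengthOn γ t τ).toReal + a = (lengthOn γ s τ).toReal := by
      rw [← e, ENNReal.toReal_add h1 (lengthOn_ne_top_of_le γ hst hτ.2 h), add_comm]
    simp only [e']
    exact naturalParameterization_lengthOn γ h ⟨hst.trans hτ.1, hτ.2⟩

lemma qhLengthOn_mono (γ : Path x y) {s t s' t' : I} (hs : s' ≤ s) (hst : s ≤ t) (ht : t ≤ t') :
    qhLengthOn D γ s t ≤ qhLengthOn D γ s' t' := by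
  rw [← qhLengthOn_add_qhLengthOn D γ (hs.trans hst) ht, ← qhLengthOn_add_qhLengthOn D γ hs hst]
  exact le_add_self.trans le_self_add

lemma qhLengthOn_le_of_le_bdist (γ : Path x y) {s t : I} (hst : s ≤ t) {m : ℝ} (hm : 0 < m)
    (h : ∀ τ ∈ Icc s t, m ≤ bdist D (γ τ)) :
    qhLengthOn D γ s t ≤ ENNReal.ofReal (1 / m) * lengthOn γ s t := by
  by_cases hl : lengthOn γ s t = ∞
  · rw [hl, ENNReal.mul_top (by simpa using hm)]
    exact le_top
  rw [qhLengthOn, if_neg hl]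
  calc _ ≤ ∫⁻ _ in Icc (0 : ℝ) (lengthOn γ s t).toReal, ENNReal.ofReal (1 / m) := by
        refine setLIntegral_mono' measurableSet_Icc fun u hu => ENNReal.ofReal_le_ofReal ?_
        obtain ⟨τ, hτ, rfl⟩ := exists_lengthOn_eq γ hst hl hu
        rw [naturalParameterization_lengthOn γ hl hτ]
        exact one_div_le_one_div_of_le hm (h τ hτ)
    _ = _ := by
        rw [setLIntegral_const, Real.volume_Icc, sub_zero, ENNReal.ofReal_toReal hl]

lemma le_qhLengthOn_of_bdist_le (γ : Path x y) {s t : I} (hst : s ≤ t) {m : ℝ}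
    (h : ∀ τ ∈ Icc s t, 0 < bdist D (γ τ) ∧ bdist D (γ τ) ≤ m) :
    ENNReal.ofReal (1 / m) * lengthOn γ s t ≤ qhLengthOn D γ s t := by
  by_cases hl : lengthOn γ s t = ∞
  · rw [qhLengthOn_eq_top D γ hl]
    exact le_top
  rw [qhLengthOn, if_neg hl]
  calc _ = ∫⁻ _ in Icc (0 : ℝ) (lengthOn γ s t).toReal, ENNReal.ofReal (1 / m) := by
        rw [setLIntegral_const, Real.volume_Icc, sub_zero, ENNReal.ofReal_toReal hl]
    _ ≤ _ := by
        refine setLIntegral_mono' measurableSet_Icc fun u hu => ENNReal.ofReal_le_ofReal ?_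
        obtain ⟨τ, hτ, rfl⟩ := exists_lengthOn_eq γ hst hl hu
        rw [naturalParameterization_lengthOn γ hl hτ]
        exact one_div_le_one_div_of_le (h τ hτ).1 (h τ hτ).2

end Length

/-! ### The quasihyperbolic metric -/

section Subpaths

variable {E : Type*} [NormedAddCommGroup E] {x y z : E}

lemma monotone_convexComb {s t : I} (h : s ≤ t) : Monotone (Icc.convexComb s t) := by
  intro a b hab
  have h' : (s : ℝ) ≤ t := h
  have hab' : (a : ℝ) ≤ b := hab
  rw [← Subtype.coe_le_coe, Icc.coe_convexComb, Icc.coe_convexComb]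
  nlinarith

lemma antitone_convexComb {s t : I} (h : t ≤ s) : Antitone (Icc.convexComb s t) := by
  intro a b hab
  have h' : (t : ℝ) ≤ s := h
  have hab' : (a : ℝ) ≤ b := hab
  rw [← Subtype.coe_le_coe, Icc.coe_convexComb, Icc.coe_convexComb]
  nlinarith

lemma qhLength_subpath (D : Set E) (γ : Path x y) {s t : I} (h : s ≤ t) :
    qhLength D (γ.subpath s t) = qhLengthOn D γ s t := by
  rw [qhLength, qhLengthOn_comp_of_monotone D (monotone_convexComb h)
    (Icc.continuous_convexComb s t) (fun _ => rfl) zero_le_one]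
  simp

lemma qhLengthOn_symm (D : Set E) (γ : Path x y) {s t : I} (h : s ≤ t) :
    qhLengthOn D γ.symm s t = qhLengthOn D γ (unitInterval.symm t) (unitInterval.symm s) :=
  qhLengthOn_comp_of_antitone D unitInterval.strictAnti_symm.antitone unitInterval.continuous_symm
    (fun _ => rfl) h

lemma qhLength_symm (D : Set E) (γ : Path x y) : qhLength D γ.symm = qhLength D γ := by
  rw [qhLength, qhLengthOn_symm D γ zero_le_one]
  simp [qhLength]

/-- The midpoint of the parameter interval, at which the parts of a concatenation meet. -/
noncomputable def midParam : I := ⟨1 / 2, by norm_num, by norm_num⟩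

lemma trans_convexComb_left (γ : Path x y) (γ' : Path y z) (τ : I) :
    γ τ = (γ.trans γ') (Icc.convexComb 0 midParam τ) := by
  have h : ((Icc.convexComb 0 midParam τ : I) : ℝ) = τ / 2 := by
    simp [Icc.coe_convexComb, midParam]; ring
  rw [Path.trans_apply, dif_pos (by rw [h]; linarith [τ.2.2])]
  congr 1
  ext
  simp only [h]
  ring

lemma trans_convexComb_right (γ : Path x y) (γ' : Path y z) (τ : I) :
    γ' τ = (γ.trans γ') (Icc.convexComb midParam 1 τ) := by
  have h : ((Icc.convexComb midParam 1 τ : I) : ℝ) = (1 + τ) / 2 := by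
    simp [Icc.coe_convexComb, midParam]; ring
  rw [Path.trans_apply]
  split_ifs with h'
  · have h0 : τ = 0 := by
      rw [h] at h'
      ext
      have := τ.2.1
      simp only [Icc.coe_zero]; linarith
    subst h0
    have : (⟨2 * ((Icc.convexComb midParam 1 0 : I) : ℝ),
        (unitInterval.mul_pos_mem_iff zero_lt_two).2 ⟨(Icc.convexComb midParam 1 0).2.1, h'⟩⟩ : I)
        = 1 := by
      ext; simp only [h]; simp
    rw [this, γ.target, γ'.source]
  · congr 1
    ext
    simp only [h]
    ring

lemma qhLength_trans (D : Set E) (γ : Path x y) (γ' : Path y z) :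
    qhLength D (γ.trans γ') = qhLength D γ + qhLength D γ' := by
  have h1 := qhLengthOn_comp_of_monotone D (monotone_convexComb unitInterval.nonneg')
    (Icc.continuous_convexComb 0 midParam) (trans_convexComb_left γ γ') zero_le_one
  have h2 := qhLengthOn_comp_of_monotone D (monotone_convexComb unitInterval.le_one')
    (Icc.continuous_convexComb midParam 1) (trans_convexComb_right γ γ') zero_le_one
  simp only [Icc.convexComb_zero, Icc.convexComb_one] at h1 h2
  rw [qhLength, qhLength, qhLength, h1, h2,
    qhLengthOn_add_qhLengthOn D _ unitInterval.nonneg' unitInterval.le_one']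

end Subpaths

section Distance

variable {E : Type*} [NormedAddCommGroup E] {D : Set E} {x y z : E}

lemma bdist_le_bdist_add_dist (D : Set E) (x y : E) : bdist D x ≤ bdist D y + dist x y :=
  Metric.infDist_le_infDist_add_dist

/-- The extended real valued quasihyperbolic distance, which is finite on a proper subdomain. -/
noncomputable def qhEDist (D : Set E) (x y : E) : ℝ≥0∞ :=
  ⨅ γ : {γ : Path x y // (∀ t, γ t ∈ D) ∧ length γ ≠ ∞}, qhLength D γ.1

lemma qhDist_eq_toReal (D : Set E) (x y : E) : qhDist D x y = (qhEDist D x y).toReal := rfl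

/-- Rectifiability need not be assumed, since a nonrectifiable curve has quasihyperbolic length
`∞`. -/
lemma qhEDist_le_qhLength (γ : Path x y) (hγ : ∀ t, γ t ∈ D) : qhEDist D x y ≤ qhLength D γ := by
  by_cases h : length γ = ∞
  · rw [qhLength, qhLengthOn_eq_top D γ h]
    exact le_top
  · exact iInf_le (fun γ : {γ : Path x y // (∀ t, γ t ∈ D) ∧ length γ ≠ ∞} => qhLength D γ.1)
      ⟨γ, hγ, h⟩

lemma qhEDist_le_qhLengthOn (γ : Path x y) (hγ : ∀ t, γ t ∈ D) {s t : I} (hst : s ≤ t) :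
    qhEDist D (γ s) (γ t) ≤ qhLengthOn D γ s t := by
  rw [← qhLength_subpath D γ hst]
  exact qhEDist_le_qhLength _ fun _ => hγ _

lemma qhEDist_comm (D : Set E) (x y : E) : qhEDist D x y = qhEDist D y x := by
  have key : ∀ x y : E, qhEDist D x y ≤ qhEDist D y x := fun x y =>
    le_iInf fun γ => by
      rw [← qhLength_symm]
      exact qhEDist_le_qhLength _ fun t => γ.2.1 _
  exact (key x y).antisymm (key y x)

lemma qhEDist_triangle (D : Set E) (x y z : E) :
    qhEDist D x z ≤ qhEDist D x y + qhEDist D y z := by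
  refine ENNReal.le_iInf_add_iInf fun γ γ' => ?_
  rw [← qhLength_trans]
  refine qhEDist_le_qhLength _ fun t => ?_
  have : (γ.1.trans γ'.1) t ∈ range (γ.1.trans γ'.1) := mem_range_self t
  rw [Path.trans_range] at this
  rcases this with ⟨τ, hτ⟩ | ⟨τ, hτ⟩
  · exact hτ ▸ γ.2.1 τ
  · exact hτ ▸ γ'.2.1 τ

lemma qhEDist_self (hx : x ∈ D) : qhEDist D x x = 0 := by
  refine le_antisymm ((qhEDist_le_qhLength (Path.refl x) fun _ => hx).trans ?_) bot_le
  have h : lengthOn (Path.refl x) 0 1 = 0 :=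
    (eVariationOn.eq_zero_iff _).2 (by simp)
  rw [qhLength, qhLengthOn, if_neg (by simp [h]), h]
  simp

variable [NormedSpace ℝ E]

lemma IsProperSubdomain.bdist_pos (hD : IsProperSubdomain D) (hx : x ∈ D) : 0 < bdist D x := by
  refine (isClosed_frontier.notMem_iff_infDist_pos ?_).1 fun h => ?_
  · exact nonempty_frontier_iff.2 ⟨hD.isConnected.nonempty, hD.ne_univ⟩
  · rw [hD.isOpen.frontier_eq] at h
    exact h.2 hx

/-- The straight path between two points. -/
noncomputable def segmentPath (x y : E) : Path x y where
  toFun t := AffineMap.lineMap x y (t : ℝ)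
  continuous_toFun := AffineMap.lineMap_continuous.comp continuous_subtype_val
  source' := by simp
  target' := by simp

lemma segmentPath_mem_segment (x y : E) (t : I) : segmentPath x y t ∈ segment ℝ x y := by
  rw [segment_eq_image_lineMap]
  exact ⟨t, t.2, rfl⟩

lemma length_segmentPath_le (x y : E) : length (segmentPath x y) ≤ edist x y := by
  have h1 : (segmentPath x y : I → E) = AffineMap.lineMap x y ∘ (fun t : I => (t : ℝ)) := rfl
  have h2 : LipschitzOnWith (nndist x y) (AffineMap.lineMap x y : ℝ → E) (Icc 0 1) :=
    (lipschitzWith_lineMap x y).lipschitzOnWith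
  rw [length, lengthOn, h1]
  refine (h2.comp_eVariationOn_le fun t _ => t.2).trans ?_
  have h3 : eVariationOn (fun t : I => (t : ℝ)) (Icc 0 1) = ENNReal.ofReal (1 - 0) := by
    have := MonotoneOn.eVariationOn_eq (f := fun t : I => (t : ℝ)) (s := univ) (a := 0) (b := 1)
      (fun a _ b _ hab => hab) (mem_univ _) (mem_univ _)
    simpa using this
  rw [edist_nndist]
  calc _ ≤ (nndist x y : ℝ≥0∞) * ENNReal.ofReal (1 - 0) := by rw [h3]
    _ = _ := by simp

/-- Near `x`, the quasihyperbolic distance is at most `2 / d_D(x)` times the norm distance. -/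
lemma qhEDist_le_of_ball_subset (hD : IsProperSubdomain D) (hx : x ∈ D) {r : ℝ}
    (hr : Metric.ball x r ⊆ D) (hr' : r ≤ bdist D x / 2) (hy : y ∈ Metric.ball x r) :
    qhEDist D x y ≤ ENNReal.ofReal (2 / bdist D x * dist x y) := by
  have hpos := hD.bdist_pos hx
  have hmem : ∀ t, segmentPath x y t ∈ Metric.ball x r := fun t =>
    (convex_ball x r).segment_subset (Metric.mem_ball_self (dist_nonneg.trans_lt hy)) hy
      (segmentPath_mem_segment x y t)
  refine (qhEDist_le_qhLength _ fun t => hr (hmem t)).trans ?_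
  refine (qhLengthOn_le_of_le_bdist D _ zero_le_one (half_pos hpos) fun t _ => ?_).trans ?_
  · have h1 := bdist_le_bdist_add_dist D x (segmentPath x y t)
    have h2 := Metric.mem_ball'.1 (hmem t)
    linarith
  · rw [ENNReal.ofReal_mul (by positivity), ← edist_dist, one_div_div]
    gcongr
    exact length_segmentPath_le x y

lemma IsProperSubdomain.qhEDist_ne_top (hD : IsProperSubdomain D) (hx : x ∈ D) (hy : y ∈ D) :
    qhEDist D x y ≠ ∞ := by
  refine hD.isConnected.isPreconnected.induction₂ (fun x y => qhEDist D x y ≠ ∞) ?_ ?_ ?_ hx hy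
  · intro x hx
    obtain ⟨r, hr0, hr⟩ := Metric.isOpen_iff.1 hD.isOpen x hx
    refine mem_nhdsWithin_of_mem_nhds (Filter.mem_of_superset (Metric.ball_mem_nhds x
      (lt_min hr0 (half_pos (hD.bdist_pos hx)))) fun y hy => ?_)
    exact ne_top_of_le_ne_top ENNReal.ofReal_ne_top (qhEDist_le_of_ball_subset hD hx
      ((Metric.ball_subset_ball (min_le_left _ _)).trans hr) (min_le_right _ _) hy)
  · intro x y z _ _ _ hxy hyz
    exact ne_top_of_le_ne_top (ENNReal.add_ne_top.2 ⟨hxy, hyz⟩) (qhEDist_triangle D x y z)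
  · intro x y _ _ h
    rwa [qhEDist_comm]

/-- The logarithmic lower bound `log (d_D(γ t) / d_D(γ s)) ≤ ℓ_k(γ[γ s, γ t])`: by the time a curve
has covered length `u` from `γ s`, the distance to the boundary is at most `d_D(γ s) + u`. -/
lemma IsProperSubdomain.log_bdist_le_qhLength (hD : IsProperSubdomain D) (γ : Path x y)
    (hγ : ∀ t, γ t ∈ D) :
    ENNReal.ofReal (Real.log (bdist D y / bdist D x)) ≤ qhLength D γ := by
  by_cases hl : length γ = ∞
  · rw [qhLength, qhLengthOn_eq_top D γ hl]
    exact le_top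
  have hl' : lengthOn γ 0 1 ≠ ∞ := hl
  set ℓ := (lengthOn γ 0 1).toReal with hℓ
  have hℓ0 : 0 ≤ ℓ := ENNReal.toReal_nonneg
  set a := bdist D x with ha
  have ha0 : 0 < a := hD.bdist_pos (by simpa using hγ 0)
  have hy0 : 0 < bdist D y := hD.bdist_pos (by simpa using hγ 1)
  have hdist : ∀ τ : I, bdist D (γ τ) ≤ a + (lengthOn γ 0 τ).toReal := by
    intro τ
    have h1 := bdist_le_bdist_add_dist D (γ τ) x
    have h2 := edist_le_lengthOn γ (unitInterval.nonneg' (t := τ))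
    rw [γ.source, edist_dist, ENNReal.ofReal_le_iff_le_toReal
      (lengthOn_ne_top_of_le γ le_rfl unitInterval.le_one' hl')] at h2
    rw [dist_comm] at h1
    linarith
  have hint : ∫⁻ u in Icc (0 : ℝ) ℓ, ENNReal.ofReal (1 / (a + u)) =
      ENNReal.ofReal (Real.log ((a + ℓ) / a)) := by
    have hne : ∀ u ∈ Icc (0 : ℝ) ℓ, a + u ≠ 0 := fun u hu => by linarith [hu.1]
    rw [← ofReal_integral_eq_lintegral_ofReal]
    · congr 1
      rw [integral_Icc_eq_integral_Ioc, ← intervalIntegral.integral_of_le hℓ0,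
        intervalIntegral.integral_comp_add_left (fun u => 1 / u), add_zero,
        integral_one_div_of_pos ha0 (by linarith)]
    · exact ContinuousOn.integrableOn_Icc
        (continuousOn_const.div (continuousOn_const.add continuousOn_id) hne)
    · refine (ae_restrict_iff' measurableSet_Icc).2 (Filter.Eventually.of_forall fun u hu => ?_)
      have := hu.1
      simp only [Pi.zero_apply]
      positivity
  calc _ ≤ ENNReal.ofReal (Real.log ((a + ℓ) / a)) := by
        refine ENNReal.ofReal_le_ofReal (Real.log_le_log (by positivity) ?_)
        have := hdist 1
        rw [γ.target] at this
        gcongr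
    _ = ∫⁻ u in Icc (0 : ℝ) ℓ, ENNReal.ofReal (1 / (a + u)) := hint.symm
    _ ≤ _ := by
        rw [qhLength, qhLengthOn, if_neg hl']
        refine setLIntegral_mono' measurableSet_Icc fun u hu => ENNReal.ofReal_le_ofReal ?_
        obtain ⟨τ, hτ, rfl⟩ := exists_lengthOn_eq γ zero_le_one hl' hu
        rw [naturalParameterization_lengthOn γ hl' hτ]
        exact one_div_le_one_div_of_le (hD.bdist_pos (hγ τ)) (hdist τ)

/-- A quasihyperbolic ball of radius `r` is so small that `d_D` varies on it only by factors
`exp r`. -/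
lemma IsProperSubdomain.bdist_le_exp_mul (hD : IsProperSubdomain D) (hx : x ∈ D) (hy : y ∈ D)
    {r : ℝ} (hr : qhDist D x y ≤ r) : bdist D y ≤ Real.exp r * bdist D x := by
  have hx0 := hD.bdist_pos hx
  have hy0 := hD.bdist_pos hy
  have h : ENNReal.ofReal (Real.log (bdist D y / bdist D x)) ≤ qhEDist D x y :=
    le_iInf fun γ => hD.log_bdist_le_qhLength γ.1 γ.2.1
  rw [ENNReal.ofReal_le_iff_le_toReal (hD.qhEDist_ne_top hx hy), ← qhDist_eq_toReal] at h
  have h2 := (Real.log_le_iff_le_exp (by positivity)).1 (h.trans hr)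
  rwa [div_le_iff₀ hx0] at h2

/-- The points of a proper subdomain, as a pseudometric space with the quasihyperbolic metric. -/
structure QHPoint (D : Set E) (hD : IsProperSubdomain D) where
  /-- The underlying point of the normed space. -/
  val : E
  /-- The point belongs to the domain. -/
  mem : val ∈ D

variable (hD : IsProperSubdomain D)

/-- The quasihyperbolic pseudometric; its topology is not the one induced from the normed space by
definition. -/
noncomputable instance : PseudoMetricSpace (QHPoint D hD) where
  dist p q := qhDist D p.val q.val
  dist_self p := by simp [qhDist_eq_toReal, qhEDist_self p.mem]
  dist_comm p q := by rw [qhDist_eq_toReal, qhEDist_comm, ← qhDist_eq_toReal]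
  dist_triangle p q r := by
    simp only [qhDist_eq_toReal]
    rw [← ENNReal.toReal_add (hD.qhEDist_ne_top p.mem q.mem) (hD.qhEDist_ne_top q.mem r.mem)]
    exact ENNReal.toReal_mono (ENNReal.add_ne_top.2
      ⟨hD.qhEDist_ne_top p.mem q.mem, hD.qhEDist_ne_top q.mem r.mem⟩) (qhEDist_triangle D _ _ _)

lemma QHPoint.dist_def (p q : QHPoint D hD) : dist p q = qhDist D p.val q.val := rfl

/-- A curve in `D`, regarded as a map into `D` with the quasihyperbolic metric. -/
def liftPath (γ : Path x y) (hγ : ∀ t, γ t ∈ D) (t : I) : QHPoint D hD := ⟨γ t, hγ t⟩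

lemma continuous_liftPath (γ : Path x y) (hγ : ∀ t, γ t ∈ D) :
    Continuous (liftPath hD γ hγ) := by
  rw [continuous_iff_continuousAt]
  intro s
  obtain ⟨r, hr0, hr⟩ := Metric.isOpen_iff.1 hD.isOpen (γ s) (hγ s)
  have hpos := hD.bdist_pos (hγ s)
  have hball : γ ⁻¹' Metric.ball (γ s) (min r (bdist D (γ s) / 2)) ∈ nhds s :=
    γ.continuous.continuousAt (Metric.ball_mem_nhds _ (lt_min hr0 (half_pos hpos)))
  have hlim : Filter.Tendsto (fun t => 2 / bdist D (γ s) * dist (γ s) (γ t)) (nhds s)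
      (nhds 0) := by
    have : Continuous fun t => 2 / bdist D (γ s) * dist (γ s) (γ t) :=
      continuous_const.mul (continuous_const.dist γ.continuous)
    simpa using this.tendsto s
  rw [ContinuousAt, tendsto_iff_dist_tendsto_zero]
  refine squeeze_zero' (Filter.Eventually.of_forall fun _ => dist_nonneg) ?_ hlim
  filter_upwards [hball] with t ht
  rw [dist_comm, QHPoint.dist_def, qhDist_eq_toReal]
  exact ENNReal.toReal_le_of_le_ofReal (by positivity) (qhEDist_le_of_ball_subset hD (hγ s)
    ((Metric.ball_subset_ball (min_le_left _ _)).trans hr) (min_le_right _ _) ht)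

end Distance

/-! ### Quasigeodesics of the quasihyperbolic metric -/

section Quasigeodesic

variable {E : Type*} [NormedAddCommGroup E] {D : Set E} {x y x' y' : E} {c : ℝ}

lemma IsQuasigeodesic.comp_monotone {γ : Path x y} (h : IsQuasigeodesic D c γ) {γ' : Path x' y'}
    {φ : I → I} (hφ : Monotone φ) (hφc : Continuous φ) (hγ : ∀ τ, γ' τ = γ (φ τ)) :
    IsQuasigeodesic D c γ' :=
  ⟨fun t => hγ t ▸ h.1 _, fun s t hst => by
    rw [qhLengthOn_comp_of_monotone D hφ hφc hγ hst, hγ, hγ]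
    exact h.2 _ _ (hφ hst)⟩

lemma qhDist_comm (D : Set E) (x y : E) : qhDist D x y = qhDist D y x := by
  rw [qhDist_eq_toReal, qhEDist_comm, ← qhDist_eq_toReal]

lemma IsQuasigeodesic.comp_antitone {γ : Path x y} (h : IsQuasigeodesic D c γ) {γ' : Path x' y'}
    {φ : I → I} (hφ : Antitone φ) (hφc : Continuous φ) (hγ : ∀ τ, γ' τ = γ (φ τ)) :
    IsQuasigeodesic D c γ' :=
  ⟨fun t => hγ t ▸ h.1 _, fun s t hst => by
    rw [qhLengthOn_comp_of_antitone D hφ hφc hγ hst, hγ, hγ, qhDist_comm]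
    exact h.2 _ _ (hφ hst)⟩

/-- The quasihyperbolic length of the initial part of a curve, as a real number. -/
noncomputable def qhParam (D : Set E) (γ : Path x y) (t : I) : ℝ := (qhLengthOn D γ 0 t).toReal

lemma IsQuasigeodesic.qhLength_ne_top {γ : Path x y} (h : IsQuasigeodesic D c γ) :
    qhLength D γ ≠ ∞ :=
  ne_top_of_le_ne_top ENNReal.ofReal_ne_top (h.2 0 1 zero_le_one)

lemma qhLengthOn_ne_top {γ : Path x y} (h : qhLength D γ ≠ ∞) {s t : I} (hst : s ≤ t) :
    qhLengthOn D γ s t ≠ ∞ :=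
  ne_top_of_le_ne_top h (qhLengthOn_mono D γ unitInterval.nonneg' hst unitInterval.le_one')

lemma toReal_qhLengthOn {γ : Path x y} (h : qhLength D γ ≠ ∞) {s t : I} (hst : s ≤ t) :
    (qhLengthOn D γ s t).toReal = qhParam D γ t - qhParam D γ s := by
  rw [qhParam, qhParam, ← qhLengthOn_add_qhLengthOn D γ unitInterval.nonneg' hst,
    ENNReal.toReal_add (qhLengthOn_ne_top h unitInterval.nonneg') (qhLengthOn_ne_top h hst),
    add_sub_cancel_left]

lemma qhDist_le_qhParam_sub {γ : Path x y} (hγ : ∀ t, γ t ∈ D) (h : qhLength D γ ≠ ∞) {s t : I}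
    (hst : s ≤ t) : qhDist D (γ s) (γ t) ≤ qhParam D γ t - qhParam D γ s := by
  rw [← toReal_qhLengthOn h hst, qhDist_eq_toReal]
  exact ENNReal.toReal_mono (qhLengthOn_ne_top h hst) (qhEDist_le_qhLengthOn γ hγ hst)

@[simp] lemma qhParam_zero (D : Set E) (γ : Path x y) : qhParam D γ 0 = 0 := by
  simp [qhParam, qhLengthOn]

lemma toReal_lengthOn_le {γ : Path x y} (h : qhLength D γ ≠ ∞) {s t : I} (hst : s ≤ t) {m : ℝ}
    (hm : ∀ τ ∈ Icc s t, 0 < bdist D (γ τ) ∧ bdist D (γ τ) ≤ m) :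
    (lengthOn γ s t).toReal ≤ m * (qhParam D γ t - qhParam D γ s) := by
  have hm0 : 0 < m := (hm s (left_mem_Icc.2 hst)).1.trans_le (hm s (left_mem_Icc.2 hst)).2
  have h1 := ENNReal.toReal_mono (qhLengthOn_ne_top h hst) (le_qhLengthOn_of_bdist_le D γ hst hm)
  rwa [ENNReal.toReal_mul, ENNReal.toReal_ofReal (by positivity), toReal_qhLengthOn h hst,
    one_div_mul_eq_div, div_le_iff₀' hm0] at h1

lemma le_toReal_lengthOn {γ : Path x y} (h : qhLength D γ ≠ ∞) {s t : I} (hst : s ≤ t) {m : ℝ}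
    (hm0 : 0 < m) (hm : ∀ τ ∈ Icc s t, m ≤ bdist D (γ τ)) :
    m * (qhParam D γ t - qhParam D γ s) ≤ (lengthOn γ s t).toReal := by
  have h1 := ENNReal.toReal_mono
    (ENNReal.mul_ne_top ENNReal.ofReal_ne_top (lengthOn_ne_top D γ (qhLengthOn_ne_top h hst)))
    (qhLengthOn_le_of_le_bdist D γ hst hm0 hm)
  rwa [ENNReal.toReal_mul, ENNReal.toReal_ofReal (by positivity), toReal_qhLengthOn h hst,
    one_div_mul_eq_div, le_div_iff₀' hm0] at h1

/-- Thin quasigeodesic triangles make the two sides of a quasigeodesic bigon close to each other: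
an interior point of one side serves as the third vertex of a triangle. -/
lemma QuasigeodesicTrianglesThin.exists_qhDist_le {μ : ℝ}
    (hthin : QuasigeodesicTrianglesThin D c μ) (hxy : x ≠ y) {θ γ : Path x y}
    (hθ : IsQuasigeodesic D c θ) (hγ : IsQuasigeodesic D c γ) (t : I) :
    ∃ τ, qhDist D (θ t) (γ τ) ≤ μ := by
  have hpos : 0 < dist y x := dist_pos.2 hxy.symm
  obtain ⟨r, -, hr⟩ := intermediate_value_Icc (zero_le_one (α := I))
    (f := fun t => dist (γ t) x) (γ.continuous.dist continuous_const).continuousOn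
    (by
      rw [γ.source, γ.target, dist_self]
      exact ⟨(half_pos hpos).le, (half_lt_self hpos).le⟩ :
      dist y x / 2 ∈ Icc (dist (γ 0) x) (dist (γ 1) x))
  simp only at hr
  have hxz : x ≠ γ r := by
    intro h; rw [← h, dist_self] at hr; linarith
  have hyz : y ≠ γ r := by
    intro h; rw [← h] at hr; linarith
  obtain ⟨v, hv, hμ⟩ := hthin x (by simpa using hγ.1 0) y (by simpa using hγ.1 1) (γ r) (hγ.1 r)
    hxy hyz hxz θ ((γ.subpath 1 r).cast γ.target.symm rfl)
    ((γ.subpath 0 r).cast γ.source.symm rfl) hθ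
    (hγ.comp_antitone (antitone_convexComb unitInterval.le_one')
      (Icc.continuous_convexComb 1 r) fun _ => rfl)
    (hγ.comp_monotone (monotone_convexComb unitInterval.nonneg')
      (Icc.continuous_convexComb 0 r) fun _ => rfl) (θ t) (mem_range_self t)
  rcases hv with ⟨τ, rfl⟩ | ⟨τ, rfl⟩
  · exact ⟨_, hμ⟩
  · exact ⟨_, hμ⟩

variable [NormedSpace ℝ E]

lemma IsQuasigeodesic.isQuasiCurve (hD : IsProperSubdomain D) {γ : Path x y} (hc : 0 ≤ c)
    (h : IsQuasigeodesic D c γ) :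
    IsQuasiCurve c (liftPath hD γ h.1) (qhParam D γ) where
  continuous := continuous_liftPath hD γ h.1
  dist_le _ _ hst := qhDist_le_qhParam_sub h.1 h.qhLength_ne_top hst
  le_mul_dist s t hst := by
    rw [← toReal_qhLengthOn h.qhLength_ne_top hst]
    exact ENNReal.toReal_le_of_le_ofReal (mul_nonneg hc dist_nonneg) (h.2 s t hst)

/-- A curve whose quasihyperbolic length exceeds the distance of its end points by at most `1` is a
rough geodesic. -/
lemma IsProperSubdomain.exists_isRoughGeodesic (hD : IsProperSubdomain D) (p q : QHPoint D hD) :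
    ∃ α : I → QHPoint D hD, IsRoughGeodesic α ∧ α 0 = p ∧ α 1 = q := by
  have hlt : qhEDist D p.val q.val < qhEDist D p.val q.val + 1 :=
    ENNReal.lt_add_right (hD.qhEDist_ne_top p.mem q.mem) one_ne_zero
  obtain ⟨⟨γ, hγ, _⟩, hlen⟩ := iInf_lt_iff.1 hlt
  replace hlen : qhLength D γ < qhEDist D p.val q.val + 1 := hlen
  have hfin : qhLength D γ ≠ ∞ := hlen.ne_top
  have hlen' : qhParam D γ 1 ≤ qhDist D p.val q.val + 1 := by
    have := ENNReal.toReal_mono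
      (ENNReal.add_ne_top.2 ⟨hD.qhEDist_ne_top p.mem q.mem, ENNReal.one_ne_top⟩) hlen.le
    rwa [ENNReal.toReal_add (hD.qhEDist_ne_top p.mem q.mem) ENNReal.one_ne_top,
      ENNReal.toReal_one] at this
  have h0 : liftPath hD γ hγ 0 = p := by simp [liftPath]
  have h1 : liftPath hD γ hγ 1 = q := by simp [liftPath]
  refine ⟨liftPath hD γ hγ, ⟨continuous_liftPath hD γ hγ, fun s t r hst htr => ?_⟩, h0, h1⟩
  have hk : ∀ {s t : I}, s ≤ t →
      dist (liftPath hD γ hγ s) (liftPath hD γ hγ t) ≤ qhParam D γ t - qhParam D γ s :=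
    fun hst => qhDist_le_qhParam_sub hγ hfin hst
  have e1 := hk hst
  have e2 := hk htr
  have e3 := hk (unitInterval.nonneg' (t := s))
  have e4 := hk (unitInterval.le_one' (t := r))
  have e5 := dist_triangle4 (liftPath hD γ hγ 0) (liftPath hD γ hγ s) (liftPath hD γ hγ r)
    (liftPath hD γ hγ 1)
  rw [qhParam_zero] at e3
  have e6 : dist (liftPath hD γ hγ 0) (liftPath hD γ hγ 1) = qhDist D p.val q.val := by
    rw [h0, h1]; rfl
  linarith

lemma IsGromovHyperbolic.fourPoint (hD : IsProperSubdomain D) {δ : ℝ} (h : IsGromovHyperbolic D δ) :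
    FourPoint (QHPoint D hD) δ :=
  fun x y z p => h x.val x.mem y.val y.mem z.val z.mem p.val p.mem

end Quasigeodesic

/-! ### Comparing the lengths of two quasigeodesics -/

section Comparison

lemma card_le_of_forall_sub_le {S : Finset ℕ} {B : ℝ} (hB : 0 ≤ B)
    (h : ∀ a ∈ S, ∀ b ∈ S, a ≤ b → (b : ℝ) - a ≤ B) : (S.card : ℝ) ≤ B + 1 := by
  rcases S.eq_empty_or_nonempty with rfl | hS
  · simp; linarith
  have hsub : S ⊆ Finset.Icc (S.min' hS) (S.max' hS) := fun a ha =>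
    Finset.mem_Icc.2 ⟨S.min'_le a ha, S.le_max' a ha⟩
  have h1 := Finset.card_le_card hsub
  have h2 := h _ (S.min'_mem hS) _ (S.max'_mem hS) (S.min'_le _ (S.max'_mem hS))
  have h3 : S.min' hS ≤ S.max' hS := S.min'_le _ (S.max'_mem hS)
  rw [Nat.card_Icc] at h1
  have h4 : (S.card : ℝ) ≤ ((S.max' hS + 1 - S.min' hS : ℕ) : ℝ) := by exact_mod_cast h1
  rw [Nat.cast_sub (by omega)] at h4
  push_cast at h4
  linarith

lemma exists_mem_Icc_succ {α : Type*} [LinearOrder α] {T : ℕ → α} {τ : α} (h0 : T 0 ≤ τ) :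
    ∀ {N : ℕ}, 0 < N → τ ≤ T N → ∃ j < N, τ ∈ Icc (T j) (T (j + 1)) := by
  intro N
  induction N with
  | zero => intro h; omega
  | succ N ih =>
    intro _ hτ
    rcases le_total (T N) τ with h | h
    · exact ⟨N, Nat.lt_succ_self N, h, hτ⟩
    · rcases Nat.eq_zero_or_pos N with rfl | hN
      · exact ⟨0, Nat.zero_lt_one, h0, hτ⟩
      · obtain ⟨j, hj, hj'⟩ := ih hN h
        exact ⟨j, hj.trans (Nat.lt_succ_self N), hj'⟩

/-- A curve of length greater than `1` can be cut into pieces of equal length between `1 / 2` and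
`1`. -/
lemma exists_subdivision {L : I → ℝ} (hL : Monotone L) (hLc : Continuous L) (h0 : L 0 = 0)
    (h1 : 1 < L 1) : ∃ (N : ℕ) (T : ℕ → I) (h : ℝ), 0 < N ∧ Monotone T ∧ T 0 = 0 ∧ T N = 1 ∧
      1 / 2 ≤ h ∧ h ≤ 1 ∧ ∀ i ≤ N, L (T i) = i * h := by
  set N := ⌈L 1⌉₊ with hN
  have hN0 : 0 < N := Nat.ceil_pos.2 (by linarith)
  have hN0' : (0 : ℝ) < N := by exact_mod_cast hN0
  set h := L 1 / N with hh
  have hpos : 0 < h := div_pos (by linarith) hN0'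
  have hNh : N * h = L 1 := by rw [hh]; field_simp
  have hex : ∀ i : ℕ, ∃ τ : I, (i ≤ N → L τ = i * h) ∧ (i = 0 → τ = 0) ∧ (N ≤ i → τ = 1) := by
    intro i
    rcases Nat.eq_zero_or_pos i with rfl | hi
    · exact ⟨0, by simp [h0], by simp, by omega⟩
    rcases lt_or_ge i N with hiN | hiN
    · have hi' : (i : ℝ) ≤ N := by exact_mod_cast hiN.le
      obtain ⟨τ, -, hτ⟩ := intermediate_value_Icc (zero_le_one (α := I)) hLc.continuousOn
        (⟨by rw [h0]; positivity, by rw [← hNh]; gcongr⟩ : i * h ∈ Icc (L 0) (L 1))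
      exact ⟨τ, fun _ => hτ, by omega, by omega⟩
    · exact ⟨1, fun hi' => by rw [← hNh, hi'.antisymm hiN], by omega, fun _ => rfl⟩
  choose T hT hT0 hT1 using hex
  refine ⟨N, T, h, hN0, monotone_nat_of_le_succ fun i => ?_, hT0 0 rfl, hT1 N le_rfl, ?_, ?_, hT⟩
  · rcases lt_or_ge i N with hi | hi
    · by_contra! hlt
      have := hL hlt.le
      rw [hT i hi.le, hT (i + 1) hi] at this
      push_cast at this
      linarith
    · rw [hT1 (i + 1) (by omega)]
      exact unitInterval.le_one'
  · have := Nat.ceil_lt_add_one (a := L 1) (by linarith)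
    rw [hh, div_le_div_iff₀ two_pos hN0']
    linarith
  · rw [hh, div_le_one hN0']
    exact Nat.le_ceil _

variable {E : Type*} [NormedAddCommGroup E] [NormedSpace ℝ E] {D : Set E} {x y : E} {c μ : ℝ}

/-- If the end points are at quasihyperbolic distance at most `1`, then `d_D` is nearly constant
along both curves. -/
lemma IsQuasigeodesic.toReal_length_le_of_qhDist_le_one (hD : IsProperSubdomain D) (hc : 0 ≤ c)
    {θ γ : Path x y} (hθ : IsQuasigeodesic D c θ) (hγ : IsQuasigeodesic D c γ)
    (hk : qhDist D x y ≤ 1) :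
    (length θ).toReal ≤ c * Real.exp (2 * c) * (length γ).toReal := by
  have hx : x ∈ D := by simpa using hγ.1 0
  have hx0 := hD.bdist_pos hx
  have near : ∀ {η : Path x y}, IsQuasigeodesic D c η → ∀ t, qhDist D x (η t) ≤ c := by
    intro η hη t
    have q := hη.isQuasiCurve hD hc
    have h1 := q.dist_le 0 t unitInterval.nonneg'
    have h2 := q.monotone (unitInterval.le_one' (t := t))
    have h3 := q.le_mul_dist 0 1 unitInterval.nonneg'
    simp only [QHPoint.dist_def, liftPath, η.source, η.target, qhParam_zero] at h1 h3
    nlinarith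
  have hθlen : qhParam D θ 1 ≤ c * qhDist D x y := by
    simpa [QHPoint.dist_def, liftPath] using
      (hθ.isQuasiCurve hD hc).le_mul_dist 0 1 unitInterval.nonneg'
  have hγlen : qhDist D x y ≤ qhParam D γ 1 := by
    simpa [QHPoint.dist_def, liftPath] using
      (hγ.isQuasiCurve hD hc).dist_le 0 1 unitInterval.nonneg'
  have h1 := toReal_lengthOn_le hθ.qhLength_ne_top zero_le_one (m := Real.exp c * bdist D x)
    fun τ _ => ⟨hD.bdist_pos (hθ.1 τ), hD.bdist_le_exp_mul hx (hθ.1 τ) (near hθ τ)⟩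
  have h2 := le_toReal_lengthOn hγ.qhLength_ne_top zero_le_one (m := Real.exp (-c) * bdist D x)
    (by positivity) fun τ _ => by
      have := hD.bdist_le_exp_mul (hγ.1 τ) hx ((qhDist_comm D _ _).trans_le (near hγ τ))
      rwa [Real.exp_neg, inv_mul_le_iff₀ (Real.exp_pos c)]
  rw [qhParam_zero, sub_zero] at h1 h2
  have hexp : Real.exp (2 * c) * Real.exp (-c) = Real.exp c := by
    rw [← Real.exp_add]; ring_nf
  calc (length θ).toReal ≤ Real.exp c * bdist D x * qhParam D θ 1 := h1
    _ ≤ Real.exp c * bdist D x * (c * qhParam D γ 1) := by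
        gcongr
        exact hθlen.trans (by gcongr)
    _ = c * Real.exp (2 * c) * (Real.exp (-c) * bdist D x * qhParam D γ 1) := by
        rw [← hexp]; ring
    _ ≤ _ := by
        gcongr
        exact h2

/-- If the end points are at quasihyperbolic distance greater than `1`, both curves are cut into
pieces of quasihyperbolic length about `1`. Each piece is about as long as `d_D` is large there,
each piece of `θ` is near a piece of `γ`, and only boundedly many pieces of `θ` are near the same
piece of `γ`. -/
lemma IsQuasigeodesic.toReal_length_le_of_one_lt_qhDist (hD : IsProperSubdomain D) (hc : 0 ≤ c)
    (hμ : 0 ≤ μ) (hthin : QuasigeodesicTrianglesThin D c μ)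
    {θ γ : Path x y} (hθ : IsQuasigeodesic D c θ) (hγ : IsQuasigeodesic D c γ)
    (hk : 1 < qhDist D x y) :
    (length θ).toReal ≤
      (4 * c * (μ + 1) + 1) * (2 * Real.exp (μ + 3)) * (length γ).toReal := by
  have hxy : x ≠ y := by
    rintro rfl
    rw [qhDist_eq_toReal, qhEDist_self (by simpa using hγ.1 0), ENNReal.toReal_zero] at hk
    linarith
  have qθ := hθ.isQuasiCurve hD hc
  have qγ := hγ.isQuasiCurve hD hc
  have long : ∀ {η : Path x y}, IsQuasigeodesic D c η → 1 < qhParam D η 1 := by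
    intro η hη
    have := qhDist_le_qhParam_sub hη.1 hη.qhLength_ne_top (zero_le_one (α := I))
    rw [η.source, η.target, qhParam_zero, sub_zero] at this
    linarith
  obtain ⟨n, T, h, -, hT, hT0, hTn, hh, hh1, hTL⟩ := exists_subdivision qθ.monotone
    qθ.continuous_length (qhParam_zero D θ) (long hθ)
  obtain ⟨m, S, k, hm, hS, hS0, hSm, hk2, hk1, hSL⟩ := exists_subdivision qγ.monotone
    qγ.continuous_length (qhParam_zero D γ) (long hγ)
  -- `T` and `S` cut `θ` and `γ`; the two lengths are the sums of the lengths of the pieces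
  have split : ∀ {η : Path x y}, IsQuasigeodesic D c η → ∀ {U : ℕ → I} {l : ℕ}, Monotone U →
      U 0 = 0 → U l = 1 → (length η).toReal =
        ∑ i ∈ Finset.range l, (lengthOn η (U i) (U (i + 1))).toReal := by
    intro η hη U l hU hU0 hUl
    rw [length, ← hU0, ← hUl, lengthOn, ← eVariationOn.sum' _ hU, ENNReal.toReal_sum]
    · rfl
    · exact fun i _ =>
        lengthOn_ne_top D η (qhLengthOn_ne_top hη.qhLength_ne_top (hU (Nat.le_succ i)))
  -- on a piece, of quasihyperbolic length at most `1`, `d_D` varies by at most a factor `exp 1`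
  have upper : ∀ i < n, (lengthOn θ (T i) (T (i + 1))).toReal ≤
      Real.exp 1 * bdist D (θ (T i)) := by
    intro i hi
    have hstep : qhParam D θ (T (i + 1)) - qhParam D θ (T i) = h := by
      rw [hTL _ hi, hTL _ hi.le]; push_cast; ring
    have h1 := toReal_lengthOn_le hθ.qhLength_ne_top (hT (Nat.le_succ i))
      (m := Real.exp 1 * bdist D (θ (T i))) fun τ hτ => ⟨hD.bdist_pos (hθ.1 τ),
        hD.bdist_le_exp_mul (hθ.1 _) (hθ.1 _)
          (by
            have e1 := qhDist_le_qhParam_sub hθ.1 hθ.qhLength_ne_top hτ.1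
            have e2 := qθ.monotone hτ.2
            linarith)⟩
    rw [Nat.succ_eq_add_one, hstep] at h1
    have := hD.bdist_pos (hθ.1 (T i))
    exact h1.trans (mul_le_of_le_one_right (by positivity) hh1)
  have lower : ∀ j < m, bdist D (γ (S j)) ≤
      2 * Real.exp 1 * (lengthOn γ (S j) (S (j + 1))).toReal := by
    intro j hj
    have hstep : qhParam D γ (S (j + 1)) - qhParam D γ (S j) = k := by
      rw [hSL _ hj, hSL _ hj.le]; push_cast; ring
    have hpos := hD.bdist_pos (hγ.1 (S j))
    have h1 := le_toReal_lengthOn hγ.qhLength_ne_top (hS (Nat.le_succ j))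
      (m := (Real.exp 1)⁻¹ * bdist D (γ (S j))) (by positivity) fun τ hτ => by
        rw [inv_mul_le_iff₀ (Real.exp_pos 1)]
        refine hD.bdist_le_exp_mul (hγ.1 _) (hγ.1 _) ?_
        have e1 := qhDist_le_qhParam_sub hγ.1 hγ.qhLength_ne_top hτ.1
        have e2 := qγ.monotone hτ.2
        rw [qhDist_comm]
        linarith
    rw [Nat.succ_eq_add_one, hstep] at h1
    have h2 : (Real.exp 1)⁻¹ * bdist D (γ (S j)) * (1 / 2) ≤
        (Real.exp 1)⁻¹ * bdist D (γ (S j)) * k := by gcongr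
    have h3 := h2.trans h1
    rw [mul_assoc, inv_mul_le_iff₀ (Real.exp_pos 1)] at h3
    linarith
  have close : ∀ i, ∃ j < m, qhDist D (θ (T i)) (γ (S j)) ≤ μ + 1 := by
    intro i
    obtain ⟨τ, hτ⟩ := hthin.exists_qhDist_le hxy hθ hγ (T i)
    obtain ⟨j, hj, hjτ⟩ := exists_mem_Icc_succ (T := S) (τ := τ)
      (by rw [hS0]; exact unitInterval.nonneg') hm
      (by rw [hSm]; exact unitInterval.le_one')
    refine ⟨j, hj, ?_⟩
    have e1 := qhDist_le_qhParam_sub hγ.1 hγ.qhLength_ne_top hjτ.1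
    have e2 := qγ.monotone hjτ.2
    rw [hSL _ hj] at e2
    rw [hSL _ hj.le] at e1
    push_cast at e2
    have e3 : qhDist D (θ (T i)) (γ (S j)) ≤
        qhDist D (θ (T i)) (γ τ) + qhDist D (γ τ) (γ (S j)) :=
      dist_triangle (liftPath hD θ hθ.1 (T i)) (liftPath hD γ hγ.1 τ) (liftPath hD γ hγ.1 (S j))
    rw [qhDist_comm D (γ τ)] at e3
    linarith
  choose J hJm hJ using close
  -- pieces of `θ` near the same piece of `γ` are at distance at most `2 * (μ + 1)` from each other,
  -- so at most `2 * c * (μ + 1)` apart along `θ`, and each piece has length at least `1 / 2`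
  have few : ∀ j, ((((Finset.range n).filter fun i => J i = j).card : ℕ) : ℝ) ≤
      4 * c * (μ + 1) + 1 := by
    intro j
    refine card_le_of_forall_sub_le (by positivity) fun a ha b hb hab => ?_
    rw [Finset.mem_filter, Finset.mem_range] at ha hb
    have e1 := qθ.le_mul_dist _ _ (hT hab)
    rw [hTL _ ha.1.le, hTL _ hb.1.le] at e1
    have e2 : dist (liftPath hD θ hθ.1 (T a)) (liftPath hD θ hθ.1 (T b)) ≤
        (μ + 1) + (μ + 1) := by
      refine (dist_triangle_right _ _ (liftPath hD γ hγ.1 (S j))).trans (add_le_add ?_ ?_)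
      · exact ha.2 ▸ hJ a
      · exact hb.2 ▸ hJ b
    have e3 := mul_le_mul_of_nonneg_left e2 hc
    have e4 : (0 : ℝ) ≤ (b : ℝ) - a := by
      rw [sub_nonneg]; exact_mod_cast hab
    nlinarith
  calc (length θ).toReal
      = ∑ i ∈ Finset.range n, (lengthOn θ (T i) (T (i + 1))).toReal := split hθ hT hT0 hTn
    _ ≤ ∑ i ∈ Finset.range n, Real.exp (μ + 2) * bdist D (γ (S (J i))) := by
        refine Finset.sum_le_sum fun i hi => ?_
        refine (upper i (Finset.mem_range.1 hi)).trans ?_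
        have := hD.bdist_le_exp_mul (hγ.1 (S (J i))) (hθ.1 (T i))
          ((qhDist_comm D _ _).trans_le (hJ i))
        calc _ ≤ Real.exp 1 * (Real.exp (μ + 1) * bdist D (γ (S (J i)))) := by gcongr
          _ = _ := by rw [← mul_assoc, ← Real.exp_add]; ring_nf
    _ = ∑ j ∈ Finset.range m, ∑ i ∈ (Finset.range n).filter fun i => J i = j,
          Real.exp (μ + 2) * bdist D (γ (S (J i))) :=
        (Finset.sum_fiberwise_of_maps_to (fun i _ => Finset.mem_range.2 (hJm i)) _).symm
    _ ≤ ∑ j ∈ Finset.range m, (4 * c * (μ + 1) + 1) * (2 * Real.exp (μ + 3)) *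
          (lengthOn γ (S j) (S (j + 1))).toReal := by
        refine Finset.sum_le_sum fun j hj => ?_
        have hpos := hD.bdist_pos (hγ.1 (S j))
        rw [Finset.sum_congr rfl (g := fun _ => Real.exp (μ + 2) * bdist D (γ (S j)))
          (fun i hi => by rw [(Finset.mem_filter.1 hi).2]), Finset.sum_const, nsmul_eq_mul]
        calc _ ≤ (4 * c * (μ + 1) + 1) * (Real.exp (μ + 2) *
                (2 * Real.exp 1 * (lengthOn γ (S j) (S (j + 1))).toReal)) := by
              gcongr
              · exact few j
              · exact lower j (Finset.mem_range.1 hj)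
          _ = _ := by
              have : Real.exp (μ + 3) = Real.exp (μ + 2) * Real.exp 1 := by
                rw [← Real.exp_add]; ring_nf
              rw [this]; ring
    _ = _ := by rw [← Finset.mul_sum, ← split hγ hS hS0 hSm]

/-- The constants of the two cases are below `4 * exp (8 * c ^ 2 * μ)`. -/
lemma IsQuasigeodesic.length_le (hD : IsProperSubdomain D) (hc : 1 < c)
    (hμ : 1 / 4 + 16 + 2 * 16 ≤ μ) (hthin : QuasigeodesicTrianglesThin D c μ) {θ γ : Path x y}
    (hθ : IsQuasigeodesic D c θ) (hγ : IsQuasigeodesic D c γ) :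
    length θ ≤ ENNReal.ofReal (4 * Real.exp (8 * c ^ 2 * μ)) * length γ := by
  have hc0 : 0 ≤ c := by linarith
  have hfin : ∀ {η : Path x y}, IsQuasigeodesic D c η → length η ≠ ∞ := fun hη =>
    lengthOn_ne_top D _ hη.qhLength_ne_top
  have hcμ : c ≤ c * μ := by nlinarith
  have hccμ : c * μ ≤ c ^ 2 * μ := by
    rw [sq, mul_assoc]; exact le_mul_of_one_le_left (by nlinarith) hc.le
  have key : (length θ).toReal ≤ 4 * Real.exp (8 * c ^ 2 * μ) * (length γ).toReal := by
    rcases le_or_gt (qhDist D x y) 1 with hk | hk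
    · refine (hθ.toReal_length_le_of_qhDist_le_one hD hc0 hγ hk).trans
        (mul_le_mul_of_nonneg_right ?_ ENNReal.toReal_nonneg)
      calc c * Real.exp (2 * c) ≤ Real.exp c * Real.exp (2 * c) := by
            gcongr
            linarith [Real.add_one_le_exp c]
        _ = Real.exp (3 * c) := by rw [← Real.exp_add]; ring_nf
        _ ≤ Real.exp (8 * c ^ 2 * μ) := Real.exp_le_exp.2 (by nlinarith)
        _ ≤ _ := by linarith [Real.exp_pos (8 * c ^ 2 * μ)]
    · refine (hθ.toReal_length_le_of_one_lt_qhDist hD hc0 (by linarith) hthin hγ hk).trans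
        (mul_le_mul_of_nonneg_right ?_ ENNReal.toReal_nonneg)
      calc (4 * c * (μ + 1) + 1) * (2 * Real.exp (μ + 3))
          ≤ Real.exp (5 * (c * μ)) * (2 * Real.exp (μ + 3)) := by
            gcongr
            have h1 : 48 * c ≤ c * μ := by nlinarith
            linarith [Real.add_one_le_exp (5 * (c * μ))]
        _ = 2 * Real.exp (5 * (c * μ) + (μ + 3)) := by rw [Real.exp_add (5 * _)]; ring
        _ ≤ 2 * Real.exp (8 * c ^ 2 * μ) := by
            gcongr
            have h2 : μ ≤ c * μ := le_mul_of_one_le_left (by linarith) hc.le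
            linarith
        _ ≤ _ := by linarith [Real.exp_pos (8 * c ^ 2 * μ)]
  rw [← ENNReal.ofReal_toReal (hfin hθ), ← ENNReal.ofReal_toReal (hfin hγ),
    ← ENNReal.ofReal_mul (by positivity)]
  exact ENNReal.ofReal_le_ofReal key

end Comparison

/-- Quasigeodesic triangles in hyperbolic domains are thin, uniformly in the domain and the
space. -/
theorem exists_quasigeodesicTrianglesThin_constant (δ c : ℝ) (hc : 1 ≤ c) :
    ∃ M : ℝ, ∀ (E : Type*) [NormedAddCommGroup E] [NormedSpace ℝ E] (D : Set E),
      IsProperSubdomain D → IsGromovHyperbolic D δ → QuasigeodesicTrianglesThin D c M := by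
  obtain ⟨M, hM⟩ := exists_thin_constant δ c hc
  refine ⟨M, fun E _ _ D hD hδ x hx y hy z hz _ _ _ γ₁ γ₂ γ₃ h₁ h₂ h₃ => ?_⟩
  rintro _ ⟨t, rfl⟩
  have hc0 : 0 ≤ c := by linarith
  obtain ⟨v, hv, hd⟩ := hM (hδ.fourPoint hD) hD.exists_isRoughGeodesic
    (h₁.isQuasiCurve hD hc0) (h₂.isQuasiCurve hD hc0) (h₃.isQuasiCurve hD hc0)
    (by simp [liftPath]) (by simp [liftPath]) (by simp [liftPath]) t
  rcases hv with ⟨τ, rfl⟩ | ⟨τ, rfl⟩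
  · exact ⟨_, Or.inl ⟨τ, rfl⟩, hd⟩
  · exact ⟨_, Or.inr ⟨τ, rfl⟩, hd⟩

end QH

theorem mainTheorem8 :
    ∃ μ₂ : ℝ → ℝ → ℝ, ∀ δ c₀ : ℝ, 0 < δ → 1 < c₀ →
      1 / 4 + 16 + 2 * 16 ≤ μ₂ δ c₀ ∧
      ∀ (E : Type*) [NormedAddCommGroup E] [NormedSpace ℝ E] [CompleteSpace E],
        2 ≤ Module.rank ℝ E →
        ∀ D : Set E, QH.IsProperSubdomain D → QH.IsGromovHyperbolic D δ →
          QH.QuasigeodesicTrianglesThin D c₀ (μ₂ δ c₀) ∧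
          ∀ μ : ℝ, 1 / 4 + 16 + 2 * 16 ≤ μ → QH.QuasigeodesicTrianglesThin D c₀ μ →
            ∀ x₁ ∈ D, ∀ x₂ ∈ D, ∀ θ γ : Path x₁ x₂,
              QH.IsQuasigeodesic D c₀ θ → QH.IsQuasigeodesic D c₀ γ →
                max (QH.length θ) (QH.length γ) ≤
                  ENNReal.ofReal (4 * Real.exp (8 * c₀ ^ 2 * μ)) *
                    min (QH.length θ) (QH.length γ) := by
  have hex : ∀ δ c₀ : ℝ, ∃ M : ℝ, 1 / 4 + 16 + 2 * 16 ≤ M ∧ (1 < c₀ →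
      ∀ (E : Type _) [NormedAddCommGroup E] [NormedSpace ℝ E] (D : Set E),
        QH.IsProperSubdomain D → QH.IsGromovHyperbolic D δ →
          QH.QuasigeodesicTrianglesThin D c₀ M) := by
    intro δ c₀
    by_cases hc : 1 < c₀
    · obtain ⟨M, hM⟩ := QH.exists_quasigeodesicTrianglesThin_constant δ c₀ hc.le
      refine ⟨max M (1 / 4 + 16 + 2 * 16), le_max_right _ _, fun _ E _ _ D hD hδ => ?_⟩
      intro x hx y hy z hz hxy hyz hxz γ₁ γ₂ γ₃ h₁ h₂ h₃ u hu
      obtain ⟨v, hv, hd⟩ := hM E D hD hδ x hx y hy z hz hxy hyz hxz γ₁ γ₂ γ₃ h₁ h₂ h₃ u hu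
      exact ⟨v, hv, hd.trans (le_max_left _ _)⟩
    · exact ⟨_, le_rfl, fun h => absurd h hc⟩
  choose μ₂ hμ₂ hthin using hex
  refine ⟨μ₂, fun δ c₀ _ hc => ⟨hμ₂ δ c₀, fun E _ _ _ _ D hD hδ =>
    ⟨hthin δ c₀ hc E D hD hδ, fun μ hμ hμthin x₁ _ x₂ _ θ γ hθ hγ => ?_⟩⟩⟩
  have hle : ∀ {η η' : Path x₁ x₂}, QH.IsQuasigeodesic D c₀ η → QH.IsQuasigeodesic D c₀ η' →
      QH.length η ≤ ENNReal.ofReal (4 * Real.exp (8 * c₀ ^ 2 * μ)) * QH.length η' :=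
    fun hη hη' => hη.length_le hD hc hμ hμthin hη'
  rcases min_choice (QH.length θ) (QH.length γ) with h | h <;> rw [h]
  · exact max_le (hle hθ hθ) (hle hγ hθ)
  · exact max_le (hle hθ hγ) (hle hγ hγ)
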